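/- **Setting.** Let $n\ge 1$ agents choose decisions in a convex closed set $\mathbb X\subseteq\mathbb R^p$ with $\|x\|\le R$ for all $x\in\mathbb X$. For every agent $i$ and time $t\in\mathbb N_+$ let $f_{i,t}:\mathbb X\to\mathbb R$ and $g_{i,t}:\mathbb X\to\mathbb R^{m_i}$ be convex (componentwise for $g_{i,t}$) with $|f_{i,t}(x)-f_{i,t}(y)|\le F_1$ and $\|g_{i,t}(x)\|\le F_1$ for all $x,y\in\mathbb X$, and let $\partial f_{i,t}(x)\in\mathbb R^p$, $\partial g_{i,t}(x)\in\mathbb R^{p\times m_i}$ be subgradients at $x\in\mathbb X$ (the columns of $\partial g_{i,t}(x)$ are subgradients of the components of $g_{i,t}$) with $\|\partial f_{i,t}(x)\|\le F_2$ and $\|\partial g_{i,t}(x)\|\le F_2$. Write $[\cdot]_+$ for the componentwise positive part, and let $\partial[g_{i,t}(x)]_+$ be a subgradient of $[g_{i,t}]_+$ at $x$ whose columns are the columns of $\partial g_{i,t}(x)$ multiplied by numbers in $[0,1]$ (the rule for the maximum of a convex function and $0$). Put $f_t=\frac1n\sum_{j=1}^n f_{j,t}$, $g_t=\mathrm{col}(g_{1,t},\dots,g_{n,t})$,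 and let $$\mathcal X_T=\{(y_1,\dots,y_T): y_t\in\mathbb X,\ g_t(y_t)\le 0\ \ \forall t\in[T]\}.$$ Assume that $\mathcal X_T$ contains a constant sequence. At time $t$ the agents communicate over a directed graph $([n],\mathcal E_t)$ with mixing matrix $W_t\in\mathbb R^{n\times n}$ such that $[W_t]_{ij}>0$ if $(j,i)\in\mathcal E_t$ or $i=j$, and $[W_t]_{ij}=0$ otherwise. For all $t\in\mathbb N_+$: all positive entries of $W_t$ are at least $w\in(0,1)$, $W_t$ is doubly stochastic, and the graph $([n],\bigcup_{l=0}^{B-1}\mathcal E_{t+l})$ is strongly connected, where $B\ge1$ is a fixed integer. **Algorithm.** Let $c>1$, $\kappa\in(0,1)$ and, for $t\in\mathbb N_+$, $$\tau_t=\frac1{c^t},\quad \Psi_t=\sum_{s=1}^t\tau_s,\quad \alpha_t=\sqrt{\Psi_t/t},\quad \beta_t=\frac1{t^{\kappa}},\quad \gamma_t=\frac1{t^{1-\kappa}}.$$ Start with any $x_{i,1}\in\mathbb X$, $\hat x_{i,1}=x_{i,1}$, $q_{i,1}=0\in\mathbb R^{m_i}$. For $t=1,\dots,T-1$ and every agent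 $i$ set $$z_{i,t+1}=\sum_{j=1}^n[W_t]_{ij}\hat x_{j,t},\qquad \omega_{i,t+1}=\partial f_{i,t}(x_{i,t})+\partial[g_{i,t}(x_{i,t})]_+\,q_{i,t},\qquad x_{i,t+1}=\mathcal P_{\mathbb X}(z_{i,t+1}-\alpha_{t+1}\omega_{i,t+1}),$$ $$q_{i,t+1}=\Big[(1-\beta_{t+1}\gamma_{t+1})q_{i,t}+\gamma_{t+1}\Big([g_{i,t}(x_{i,t})]_++\big(\partial[g_{i,t}(x_{i,t})]_+\big)^{T}(x_{i,t+1}-x_{i,t})\Big)\Big]_+,$$ where $\mathcal P_{\mathbb X}$ is the Euclidean projection onto $\mathbb X$; then set $\hat x_{i,t+1}=x_{i,t+1}$ if $\|x_{i,t+1}-\hat x_{i,t}\|\ge\tau_{t+1}$, and $\hat x_{i,t+1}=\hat x_{i,t}$ otherwise. **Claim.** For every $T\in\mathbb N_+$ and every comparator sequence $y_{[T]}=(y_1,\dots,y_T)\in\mathcal X_T$ with path-length $P_T=\sum_{t=1}^{T-1}\|y_{t+1}-y_t\|$, $$\text{Net-Reg}:=\frac1n\sum_{i=1}^n\sum_{t=1}^T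 f_t(x_{i,t})-\sum_{t=1}^T f_t(y_t)\ \le\ C\big(T^{\max\{\kappa,1/2\}}+T^{1/2}P_T\big),$$ $$\text{Net-CCV}:=\frac1n\sum_{i=1}^n\sum_{t=1}^T\big\|[g_t(x_{i,t})]_+\big\|\ \le\ C\,T^{\max\{1-\kappa/2,\,3/4\}},$$ where $C>0$ depends only on $n,m_1,\dots,m_n,F_1,F_2,R,w,B,\kappa,c$. -/

import Mathlib

open scoped BigOperators

noncomputable section

namespace EventTriggered

/-- `ℝ^d` with the Euclidean norm. -/
abbrev Vec (d : ℕ) : Type := EuclideanSpace ℝ (Fin d)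

/-- `[v]₊`, the projection of `v` onto the nonnegative orthant: the positive part of each
coordinate. -/
def nonnegPart {ι : Type} (v : EuclideanSpace ℝ ι) : EuclideanSpace ℝ ι :=
  WithLp.toLp 2 fun k => max (v k) 0

/-- `x` is the Euclidean projection of `u` onto `K`, i.e. the minimizer of `‖u - y‖²` over
`y ∈ K`. -/
def IsProjection {d : ℕ} (K : Set (Vec d)) (u x : Vec d) : Prop :=
  x ∈ K ∧ ∀ y ∈ K, ‖u - x‖ ^ 2 ≤ ‖u - y‖ ^ 2

/-- `v` is a subgradient at `x` of the real function `f` on `K`. -/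
def IsSubgradient {d : ℕ} (K : Set (Vec d)) (f : Vec d → ℝ) (x v : Vec d) : Prop :=
  ∀ y ∈ K, f x + inner ℝ v (y - x) ≤ f y

/-- The `d × k` matrix `G`, viewed as a linear map `ℝ^k → ℝ^d`, is a subgradient at `x` of the
vector-valued function `g` on `K`: its columns are subgradients of the components of `g`. -/
def IsSubgradientMatrix {d k : ℕ} (K : Set (Vec d)) (g : Vec d → Vec k) (x : Vec d)
    (G : Vec k →L[ℝ] Vec d) : Prop :=
  ∀ l : Fin k, IsSubgradient K (fun y => g y l) x (G (EuclideanSpace.single l 1))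

/-- The data of the problem for `n` agents with decisions in `ℝ^p` and `m i` constraints for
agent `i`. Iterations are numbered `1, 2, 3, …`; the values at time `0` are never used, and the
functions are only used on the decision set. -/
structure Problem (n p : ℕ) (m : Fin n → ℕ) where
  /-- the decision set -/
  X : Set (Vec p)
  /-- the local loss functions `f_{i,t}` -/
  f : Fin n → ℕ → Vec p → ℝ
  /-- the local constraint functions `g_{i,t}` -/
  g : (i : Fin n) → ℕ → Vec p → Vec (m i)
  /-- the subgradients `∂f_{i,t}(x)` -/
  subf : Fin n → ℕ → Vec p → Vec p
  /-- the subgradients `∂g_{i,t}(x)` -/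
  subg : (i : Fin n) → ℕ → Vec p → (Vec (m i) →L[ℝ] Vec p)
  /-- the subgradients `∂[g_{i,t}(x)]₊` -/
  subgPos : (i : Fin n) → ℕ → Vec p → (Vec (m i) →L[ℝ] Vec p)
  /-- the communication graphs; `(graph t).Adj j i` means that `i` can receive from `j` -/
  graph : ℕ → Digraph (Fin n)
  /-- the mixing matrices -/
  W : ℕ → Matrix (Fin n) (Fin n) ℝ

namespace Problem

variable {n p : ℕ} {m : Fin n → ℕ}

/-- The global loss function `f_t = (1/n) ∑_j f_{j,t}`. -/
def globalLoss (P : Problem n p m) (t : ℕ) (x : Vec p) : ℝ :=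
  (1 / (n : ℝ)) * ∑ j : Fin n, P.f j t x

/-- The global constraint function `g_t = col(g_{1,t}, …, g_{n,t})`. -/
def globalConstraint (P : Problem n p m) (t : ℕ) (x : Vec p) :
    EuclideanSpace ℝ ((i : Fin n) × Fin (m i)) :=
  WithLp.toLp 2 fun k => P.g k.1 t x k.2

/-- The feasible decision sequences `(y_1, …, y_T)` (the other values of `y` are irrelevant). -/
def feasibleSequences (P : Problem n p m) (T : ℕ) : Set (ℕ → Vec p) :=
  {y | ∀ t ∈ Finset.Icc 1 T, y t ∈ P.X ∧ ∀ k, P.globalConstraint t (y t) k ≤ 0}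

/-- The points whose constant sequence of length `T` is feasible. -/
def feasibleStatic (P : Problem n p m) (T : ℕ) : Set (Vec p) :=
  {x | x ∈ P.X ∧ ∀ t ∈ Finset.Icc 1 T, ∀ k, P.globalConstraint t x k ≤ 0}

/-- Assumptions on the decision set, the losses, the constraints and their subgradients. The norm
of `subg` is the operator norm, i.e. the spectral norm of the matrix. -/
structure RegularData (P : Problem n p m) (F₁ F₂ R : ℝ) : Prop where
  convex : Convex ℝ P.X
  closed : IsClosed P.X
  bounded : ∀ x ∈ P.X, ‖x‖ ≤ R
  f_convex : ∀ i t, 1 ≤ t → ConvexOn ℝ P.X (P.f i t)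
  g_convex : ∀ i t, 1 ≤ t → ∀ l : Fin (m i), ConvexOn ℝ P.X (fun x => P.g i t x l)
  f_bound : ∀ i t, 1 ≤ t → ∀ x ∈ P.X, ∀ y ∈ P.X, |P.f i t x - P.f i t y| ≤ F₁
  g_bound : ∀ i t, 1 ≤ t → ∀ x ∈ P.X, ‖P.g i t x‖ ≤ F₁
  subf_spec : ∀ i t, 1 ≤ t → ∀ x ∈ P.X, IsSubgradient P.X (P.f i t) x (P.subf i t x)
  subg_spec : ∀ i t, 1 ≤ t → ∀ x ∈ P.X, IsSubgradientMatrix P.X (P.g i t) x (P.subg i t x)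
  subf_bound : ∀ i t, 1 ≤ t → ∀ x ∈ P.X, ‖P.subf i t x‖ ≤ F₂
  subg_bound : ∀ i t, 1 ≤ t → ∀ x ∈ P.X, ‖P.subg i t x‖ ≤ F₂

/-- `subgPos` is a subgradient of `[g]₊`, of the form given by the calculus rule for the maximum of
a convex function and `0`: each column is `θ ∂g_l` for some `θ ∈ [0,1]`. (Where `g_l > 0` one can
take `θ = 1`, where `g_l < 0` one can take `θ = 0`, and where `g_l = 0` any `θ`.) -/
structure PosPartSubgradients (P : Problem n p m) : Prop where
  isSubgradient : ∀ i t, 1 ≤ t → ∀ x ∈ P.X,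
    IsSubgradientMatrix P.X (fun y => nonnegPart (P.g i t y)) x (P.subgPos i t x)
  chain_rule : ∀ i t, 1 ≤ t → ∀ x ∈ P.X, ∀ l : Fin (m i), ∃ θ ∈ Set.Icc (0 : ℝ) 1,
    P.subgPos i t x (EuclideanSpace.single l 1) = θ • P.subg i t x (EuclideanSpace.single l 1)

/-- Assumptions on the time-varying communication graph and its mixing matrices. -/
structure RegularNetwork (P : Problem n p m) (w : ℝ) (B : ℕ) : Prop where
  weight_pos : ∀ t, 1 ≤ t → ∀ i j, (P.graph t).Adj j i ∨ i = j → 0 < P.W t i j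
  weight_zero : ∀ t, 1 ≤ t → ∀ i j, ¬ ((P.graph t).Adj j i ∨ i = j) → P.W t i j = 0
  weight_lower : ∀ t, 1 ≤ t → ∀ i j, 0 < P.W t i j → w ≤ P.W t i j
  col_sum : ∀ t, 1 ≤ t → ∀ j, ∑ i, P.W t i j = 1
  row_sum : ∀ t, 1 ≤ t → ∀ i, ∑ j, P.W t i j = 1
  /-- the union of any `B` consecutive graphs is strongly connected -/
  jointly_connected : ∀ t, 1 ≤ t → ∀ i j : Fin n,
    Relation.ReflTransGen (fun a b => ∃ l < B, (P.graph (t + l)).Adj a b) i j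

end Problem

/-- The variables of the algorithm: decisions `x_{i,t}`, last broadcast decisions `xhat_{i,t}`,
consensus variables `z_{i,t}`, update directions `ω_{i,t}` and dual variables `q_{i,t}`. -/
structure Trajectory (n p : ℕ) (m : Fin n → ℕ) where
  x : Fin n → ℕ → Vec p
  xhat : Fin n → ℕ → Vec p
  z : Fin n → ℕ → Vec p
  ω : Fin n → ℕ → Vec p
  q : (i : Fin n) → ℕ → Vec (m i)

/-- `S` is generated, up to iteration `T`, by the distributed event-triggered online primal-dual
algorithm with step sizes `α`, `β`, regularization parameters `γ` and thresholds `τ`. -/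
structure IsGenerated {n p : ℕ} {m : Fin n → ℕ} (P : Problem n p m) (α β γ τ : ℕ → ℝ) (T : ℕ)
    (S : Trajectory n p m) : Prop where
  init_x : ∀ i, S.x i 1 ∈ P.X
  init_xhat : ∀ i, S.xhat i 1 = S.x i 1
  init_q : ∀ i, S.q i 1 = 0
  step_z : ∀ i t, 1 ≤ t → t < T → S.z i (t + 1) = ∑ j, P.W t i j • S.xhat j t
  step_ω : ∀ i t, 1 ≤ t → t < T →
    S.ω i (t + 1) = P.subf i t (S.x i t) + P.subgPos i t (S.x i t) (S.q i t)
  step_x : ∀ i t, 1 ≤ t → t < T →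
    IsProjection P.X (S.z i (t + 1) - α (t + 1) • S.ω i (t + 1)) (S.x i (t + 1))
  step_q : ∀ i t, 1 ≤ t → t < T →
    S.q i (t + 1) = nonnegPart ((1 - β (t + 1) * γ (t + 1)) • S.q i t +
      γ (t + 1) • (nonnegPart (P.g i t (S.x i t)) +
        ContinuousLinearMap.adjoint (P.subgPos i t (S.x i t)) (S.x i (t + 1) - S.x i t)))
  step_xhat : ∀ i t, 1 ≤ t → t < T →
    S.xhat i (t + 1) =
      if τ (t + 1) ≤ ‖S.x i (t + 1) - S.xhat i t‖ then S.x i (t + 1) else S.xhat i t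

/-- Network regret of the decisions `x_{i,t}` against the benchmark `(y_1, …, y_T)`. -/
def netReg {n p : ℕ} {m : Fin n → ℕ} (P : Problem n p m) (T : ℕ) (x : Fin n → ℕ → Vec p)
    (y : ℕ → Vec p) : ℝ :=
  (1 / (n : ℝ)) * ∑ i, ∑ t ∈ Finset.Icc 1 T, P.globalLoss t (x i t)
    - ∑ t ∈ Finset.Icc 1 T, P.globalLoss t (y t)

/-- Network cumulative constraint violation of the decisions `x_{i,t}`. -/
def netCCV {n p : ℕ} {m : Fin n → ℕ} (P : Problem n p m) (T : ℕ) (x : Fin n → ℕ → Vec p) : ℝ :=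
  (1 / (n : ℝ)) * ∑ i, ∑ t ∈ Finset.Icc 1 T, ‖nonnegPart (P.globalConstraint t (x i t))‖

/-- The path-length `P_T = ∑_{t=1}^{T-1} ‖y_{t+1} - y_t‖`. -/
def pathLength {p : ℕ} (T : ℕ) (y : ℕ → Vec p) : ℝ :=
  ∑ t ∈ Finset.Ico 1 T, ‖y (t + 1) - y t‖

/-- The thresholds `τ_t = 1 / c^t`. -/
def geomThreshold (c : ℝ) (t : ℕ) : ℝ := 1 / c ^ t

/-- The step sizes `α_t = √(Ψ_t / t)` with `Ψ_t = ∑_{s=1}^t τ_s`. -/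
def stepAlpha (τ : ℕ → ℝ) (t : ℕ) : ℝ := Real.sqrt ((∑ s ∈ Finset.Icc 1 t, τ s) / t)

/-- The step sizes `β_t = 1 / t^κ`. -/
def stepBeta (κ : ℝ) (t : ℕ) : ℝ := 1 / (t : ℝ) ^ κ

/-- The regularization parameters `γ_t = 1 / t^(1-κ)`. -/
def regGamma (κ : ℝ) (t : ℕ) : ℝ := 1 / (t : ℝ) ^ (1 - κ)

end EventTriggered

end

/-!
In a drift analysis weighted by `1 / α_t`, one primal step and one dual step of every agent give,
for each constant dual comparator `r (1, …, 1)`, an upper bound on the local regret plus `r` times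
the local violation plus half the step energy `∑ ‖x_{i,t+1} - z_{i,t+1}‖² / α_{t+1}`. What remains
on the right is controlled by the total step `A = ∑ ‖x_{i,t+1} - z_{i,t+1}‖`, because joint
connectivity bounds the disagreement of the agents by a multiple of `1 + A`, and Cauchy–Schwarz
bounds `A` by `Q / s + s O(√T)` in terms of the energy `Q`, for every `s > 0`. With `r = 0` and a
large constant `s` the energy absorbs `A`, which gives the regret and `Q = O(T)`; then
`s = T^{1/4}` gives `A = O(T^{3/4})`, and `r = T^{κ/2}` balances the violation.
-/

namespace EventTriggered

section FiniteSums

lemma sum_add_le_sum_of_maps_to {u : ℕ → ℝ} (hu : ∀ t, 0 ≤ u t) {s s' : Finset ℕ} {k : ℕ}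
    (h : ∀ t ∈ s, t + k ∈ s') : ∑ t ∈ s, u (t + k) ≤ ∑ t ∈ s', u t := by
  rw [← Finset.sum_image (s := s) (g := (· + k)) (f := u) fun a _ b _ hab => by simpa using hab]
  exact Finset.sum_le_sum_of_subset_of_nonneg (Finset.image_subset_iff.2 h) fun t _ _ => hu t

lemma sum_Ico_succ_le_sum_Icc {u : ℕ → ℝ} (hu : ∀ t, 0 ≤ u t) (T : ℕ) :
    ∑ t ∈ Finset.Ico 1 T, u (t + 1) ≤ ∑ t ∈ Finset.Icc 1 T, u t :=
  sum_add_le_sum_of_maps_to hu fun t ht => by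
    simp only [Finset.mem_Ico, Finset.mem_Icc] at ht ⊢
    omega

lemma sum_range_window_le {e : ℕ → ℝ} (he : ∀ t, 0 ≤ e t) (L T : ℕ) :
    ∑ t ∈ Finset.Icc 1 (T - L), ∑ k ∈ Finset.range L, e (t + k) ≤
      L * ∑ t ∈ Finset.Ico 1 T, e t := by
  rw [Finset.sum_comm]
  refine (Finset.sum_le_card_nsmul (Finset.range L) _ (∑ t ∈ Finset.Ico 1 T, e t)
    fun k hk => sum_add_le_sum_of_maps_to he fun t ht => ?_).trans_eq (by simp)
  simp only [Finset.mem_range, Finset.mem_Icc, Finset.mem_Ico] at hk ht ⊢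
  omega

lemma sum_Icc_le_mul_add_sum_shift {D : ℕ → ℝ} {D₀ : ℝ} {L T : ℕ} (hD₀ : 0 ≤ D₀)
    (hD : ∀ t, 1 ≤ t → t ≤ T → D t ≤ D₀) :
    ∑ t ∈ Finset.Icc 1 T, D t ≤ L * D₀ + ∑ t ∈ Finset.Icc 1 (T - L), D (t + L) := by
  have head_le {N : ℕ} (hNL : N ≤ L) (hNT : N ≤ T) : ∑ t ∈ Finset.Icc 1 N, D t ≤ L * D₀ :=
    calc ∑ t ∈ Finset.Icc 1 N, D t ≤ N * D₀ := by
          simpa using Finset.sum_le_card_nsmul (Finset.Icc 1 N) D D₀ fun t ht =>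
            hD t (Finset.mem_Icc.1 ht).1 ((Finset.mem_Icc.1 ht).2.trans hNT)
      _ ≤ L * D₀ := by gcongr
  rcases le_total T L with hTL | hLT
  · simpa [Nat.sub_eq_zero_of_le hTL] using head_le hTL le_rfl
  · have split : ∑ t ∈ Finset.Icc 1 T, D t =
        ∑ t ∈ Finset.Icc 1 L, D t + ∑ t ∈ Finset.Icc 1 (T - L), D (t + L) := by
      simp only [← Finset.Ico_add_one_right_eq_Icc]
      rw [Finset.sum_Ico_add' D, ← Finset.sum_Ico_consecutive D (Nat.le_add_left 1 L)
        (Nat.add_le_add_right hLT 1)]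
      congr 3 <;> omega
    rw [split]
    gcongr
    exact head_le le_rfl hLT

lemma sum_le_of_contraction {D e : ℕ → ℝ} {ρ D₀ : ℝ} {L T : ℕ} (hD : ∀ t, 0 ≤ D t)
    (he : ∀ t, 0 ≤ e t) (hρ : 0 ≤ ρ) (hD₀ : 0 ≤ D₀) (hDD₀ : ∀ t, 1 ≤ t → t ≤ T → D t ≤ D₀)
    (h : ∀ t, 1 ≤ t → D (t + L) ≤ ρ * D t + ∑ k ∈ Finset.range L, e (t + k)) :
    (1 - ρ) * ∑ t ∈ Finset.Icc 1 T, D t ≤ L * (D₀ + ∑ t ∈ Finset.Ico 1 T, e t) := by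
  have contracted : ∑ t ∈ Finset.Icc 1 (T - L), D (t + L) ≤
      ρ * ∑ t ∈ Finset.Icc 1 T, D t + L * ∑ t ∈ Finset.Ico 1 T, e t :=
    calc ∑ t ∈ Finset.Icc 1 (T - L), D (t + L)
        ≤ ∑ t ∈ Finset.Icc 1 (T - L), (ρ * D t + ∑ k ∈ Finset.range L, e (t + k)) :=
          Finset.sum_le_sum fun t ht => h t (Finset.mem_Icc.1 ht).1
      _ = ρ * ∑ t ∈ Finset.Icc 1 (T - L), D t +
            ∑ t ∈ Finset.Icc 1 (T - L), ∑ k ∈ Finset.range L, e (t + k) := by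
          rw [Finset.sum_add_distrib, Finset.mul_sum]
      _ ≤ _ := by
          refine add_le_add (mul_le_mul_of_nonneg_left ?_ hρ) (sum_range_window_le he L T)
          exact Finset.sum_le_sum_of_subset_of_nonneg
            (Finset.Icc_subset_Icc_right (Nat.sub_le T L)) fun t _ _ => hD t
  linarith [sum_Icc_le_mul_add_sum_shift (L := L) hD₀ hDD₀]

lemma sum_mul_sub_succ_le {a d : ℕ → ℝ} {M : ℝ} {T : ℕ} (hT : 1 ≤ T) (hd₀ : ∀ t, 0 ≤ d t)
    (hd : ∀ t, 1 ≤ t → t ≤ T → d t ≤ M) (ha₁ : 0 ≤ a 1) (ha : ∀ t, 1 ≤ t → a t ≤ a (t + 1)) :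
    ∑ t ∈ Finset.Ico 1 T, a (t + 1) * (d t - d (t + 1)) ≤ a T * M := by
  have a_T_nonneg : 0 ≤ a T :=
    Nat.le_induction ha₁ (fun t ht hat => hat.trans (ha t ht)) T hT
  suffices ∑ t ∈ Finset.Ico 1 T, a (t + 1) * (d t - d (t + 1)) ≤ a T * (M - d T) from
    this.trans (mul_le_mul_of_nonneg_left (sub_le_self M (hd₀ T)) a_T_nonneg)
  clear a_T_nonneg
  induction T, hT using Nat.le_induction with
  | base => simpa using mul_nonneg ha₁ (sub_nonneg.2 (hd 1 le_rfl le_rfl))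
  | succ T hT ih =>
    rw [Finset.sum_Ico_succ_top hT]
    have previous := ih fun t h1 h2 => hd t h1 (h2.trans T.le_succ)
    have weight_gain := mul_le_mul_of_nonneg_right (ha T hT) (sub_nonneg.2 (hd T hT T.le_succ))
    linarith

lemma mul_rpow_sub_one_le_rpow_sub_rpow {x p : ℝ} (hx : 0 ≤ x) (hp₀ : 0 ≤ p) (hp₁ : p ≤ 1) :
    p * (x + 1) ^ (p - 1) ≤ (x + 1) ^ p - x ^ p := by
  have hx' : 0 < x + 1 := by positivity
  have ratio_eq : x / (x + 1) = 1 + -(1 / (x + 1)) := by field_simp; ring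
  have bernoulli : (x / (x + 1)) ^ p ≤ 1 + p * -(1 / (x + 1)) := by
    rw [ratio_eq]
    refine rpow_one_add_le_one_add_mul_self ?_ hp₀ hp₁
    rw [neg_le_neg_iff, div_le_one hx']
    exact le_add_of_nonneg_left hx
  calc p * (x + 1) ^ (p - 1) = (x + 1) ^ p * (1 - (1 + p * -(1 / (x + 1)))) := by
        rw [Real.rpow_sub_one hx'.ne']; ring
    _ ≤ (x + 1) ^ p * (1 - (x / (x + 1)) ^ p) := by gcongr
    _ = (x + 1) ^ p - x ^ p := by
        rw [Real.div_rpow hx hx'.le]; field_simp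

lemma sum_one_div_rpow_le {s : ℝ} (hs₀ : 0 ≤ s) (hs₁ : s < 1) (T : ℕ) :
    ∑ t ∈ Finset.Icc 1 T, 1 / (t : ℝ) ^ s ≤ (T : ℝ) ^ (1 - s) / (1 - s) := by
  have hs : 0 < 1 - s := sub_pos.2 hs₁
  rw [le_div_iff₀ hs]
  induction T with
  | zero => simp [Real.zero_rpow hs.ne']
  | succ T ih =>
    rw [Finset.sum_Icc_succ_top (Nat.le_add_left 1 T), add_mul]
    have increment := mul_rpow_sub_one_le_rpow_sub_rpow T.cast_nonneg hs.le (sub_le_self 1 hs₀)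
    rw [sub_sub_cancel_left, Real.rpow_neg (by positivity), ← one_div] at increment
    push_cast
    linarith

end FiniteSums

section Averaging

variable {ι : Type*} [Fintype ι] {E : Type*} [NormedAddCommGroup E] [NormedSpace ℝ E]

/-- The average of a finite family of vectors. -/
noncomputable def mean (v : ι → E) : E := (1 / (Fintype.card ι : ℝ)) • ∑ j, v j

/-- The total distance of a finite family of vectors to their average, which measures how far the
agents are from consensus. -/
noncomputable def deviation (v : ι → E) : ℝ := ∑ i, ‖v i - mean v‖

/-- The action of a matrix on families of vectors, i.e. one averaging step. -/
def mix (M : Matrix ι ι ℝ) (v : ι → E) (i : ι) : E := ∑ j, M i j • v j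

lemma deviation_nonneg (v : ι → E) : 0 ≤ deviation v :=
  Finset.sum_nonneg fun _ _ => norm_nonneg _

lemma mean_add (u v : ι → E) : mean (u + v) = mean u + mean v := by
  simp [mean, Finset.sum_add_distrib]

lemma deviation_add_le (u v : ι → E) : deviation (u + v) ≤ deviation u + deviation v := by
  unfold deviation
  rw [← Finset.sum_add_distrib]
  refine Finset.sum_le_sum fun i _ => ?_
  rw [mean_add, Pi.add_apply, add_sub_add_comm]
  exact norm_add_le _ _

lemma card_smul_mean [Nonempty ι] (v : ι → E) : (Fintype.card ι : ℝ) • mean v = ∑ i, v i := by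
  rw [mean, smul_smul, mul_one_div_cancel (by positivity), one_smul]

lemma deviation_le_two_mul_sum_norm (v : ι → E) : deviation v ≤ 2 * ∑ i, ‖v i‖ := by
  cases isEmpty_or_nonempty ι
  · simp [deviation]
  have card_mul_norm_mean_le : Fintype.card ι * ‖mean v‖ ≤ ∑ i, ‖v i‖ := by
    simpa [← card_smul_mean, norm_smul] using norm_sum_le Finset.univ v
  calc deviation v ≤ ∑ i, (‖v i‖ + ‖mean v‖) := Finset.sum_le_sum fun i _ => norm_sub_le _ _
    _ = ∑ i, ‖v i‖ + Fintype.card ι * ‖mean v‖ := by simp [Finset.sum_add_distrib]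
    _ ≤ 2 * ∑ i, ‖v i‖ := by linarith

lemma sum_sub_mean (v : ι → E) : ∑ i, (v i - mean v) = 0 := by
  cases isEmpty_or_nonempty ι
  · simp
  rw [Finset.sum_sub_distrib, Finset.sum_const, Finset.card_univ, ← Nat.cast_smul_eq_nsmul ℝ,
    card_smul_mean, sub_self]

lemma mix_add (M : Matrix ι ι ℝ) (u v : ι → E) : mix M (u + v) = mix M u + mix M v := by
  ext i; simp [mix, Finset.sum_add_distrib]

lemma mix_mul (M N : Matrix ι ι ℝ) (v : ι → E) : mix (M * N) v = mix M (mix N v) := by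
  ext i
  simp_rw [mix, Finset.smul_sum, Matrix.mul_apply, Finset.sum_smul, smul_smul]
  exact Finset.sum_comm

/-- The size of the perturbation by which `v (t + 1)` differs from one averaging step applied to
`v t`. -/
noncomputable def mixingDefect (W : ℕ → Matrix ι ι ℝ) (v : ℕ → ι → E) (t : ℕ) : ℝ :=
  ∑ i, ‖v (t + 1) i - mix (W t) (v t) i‖

lemma mixingDefect_nonneg (W : ℕ → Matrix ι ι ℝ) (v : ℕ → ι → E) (t : ℕ) :
    0 ≤ mixingDefect W v t :=
  Finset.sum_nonneg fun _ _ => norm_nonneg _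

variable [DecidableEq ι]

lemma mix_one (v : ι → E) : mix 1 v = v := by
  ext i; simp [mix, Matrix.one_apply]

lemma mean_mix {M : Matrix ι ι ℝ} (hM : M ∈ doublyStochastic ℝ ι) (v : ι → E) :
    mean (mix M v) = mean v := by
  unfold mean mix
  rw [Finset.sum_comm]
  simp_rw [← Finset.sum_smul, sum_col_of_mem_doublyStochastic hM, one_smul]

lemma mix_sub_const {M : Matrix ι ι ℝ} (hM : M ∈ doublyStochastic ℝ ι) (v : ι → E) (a : E)
    (i : ι) : mix M v i - a = ∑ j, M i j • (v j - a) := by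
  simp_rw [smul_sub, Finset.sum_sub_distrib, ← Finset.sum_smul,
    sum_row_of_mem_doublyStochastic hM i, one_smul]
  rfl

lemma deviation_mix_le {M : Matrix ι ι ℝ} (hM : M ∈ doublyStochastic ℝ ι) {η : ℝ}
    (hη : ∀ i j, η ≤ M i j) (v : ι → E) :
    deviation (mix M v) ≤ (1 - Fintype.card ι * η) * deviation v := by
  -- The deviations sum to `0`, so `η` can be subtracted from every entry of `M`.
  have mix_sub_mean (i : ι) : mix M v i - mean v = ∑ j, (M i j - η) • (v j - mean v) := by
    simp_rw [mix_sub_const hM, sub_smul, Finset.sum_sub_distrib, ← Finset.smul_sum,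
      sum_sub_mean, smul_zero, sub_zero]
  calc deviation (mix M v) = ∑ i, ‖∑ j, (M i j - η) • (v j - mean v)‖ := by
        unfold deviation; simp_rw [mean_mix hM, mix_sub_mean]
    _ ≤ ∑ i, ∑ j, (M i j - η) * ‖v j - mean v‖ := by
        refine Finset.sum_le_sum fun i _ => (norm_sum_le _ _).trans_eq ?_
        refine Finset.sum_congr rfl fun j _ => ?_
        rw [norm_smul, Real.norm_of_nonneg (sub_nonneg.2 (hη i j))]
    _ = (1 - Fintype.card ι * η) * deviation v := by
        rw [Finset.sum_comm]
        simp_rw [← Finset.sum_mul, Finset.sum_sub_distrib, sum_col_of_mem_doublyStochastic hM]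
        simp [deviation, Finset.mul_sum]

lemma deviation_mix_le_self {M : Matrix ι ι ℝ} (hM : M ∈ doublyStochastic ℝ ι) (v : ι → E) :
    deviation (mix M v) ≤ deviation v := by
  simpa using deviation_mix_le hM (η := 0) (fun _ _ => nonneg_of_mem_doublyStochastic hM) v

end Averaging

section Consensus

variable {ι : Type*} [Fintype ι] [DecidableEq ι]

/-- The product `W (t + s - 1) ⋯ W t`, which carries the values at time `t` to those at time
`t + s`. -/
noncomputable def transition (W : ℕ → Matrix ι ι ℝ) (t : ℕ) : ℕ → Matrix ι ι ℝ
  | 0 => 1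
  | s + 1 => W (t + s) * transition W t s

/-- A sequence of doubly stochastic mixing matrices, used from time `1` on, whose diagonal entries
are at least `w`, and such that over every window of length `B` the entries of size at least `w`
form a strongly connected graph; the entry `W t b a` stands for the edge from `a` to `b`. -/
structure IsConsensusNetwork (W : ℕ → Matrix ι ι ℝ) (w : ℝ) (B : ℕ) : Prop where
  weight_pos : 0 < w
  mem_doublyStochastic : ∀ t, 1 ≤ t → W t ∈ doublyStochastic ℝ ι
  le_diag : ∀ t, 1 ≤ t → ∀ i, w ≤ W t i i
  jointly_connected : ∀ t, 1 ≤ t → ∀ i j : ι,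
    Relation.ReflTransGen (fun a b => ∃ l < B, w ≤ W (t + l) b a) i j

open Classical in
/-- The agents `i` whose value at time `t + s` still contains the value of `j` at time `t` with the
weight `w ^ s` at least, i.e. as if the information had lost a factor `w` in each step. -/
noncomputable def reached (W : ℕ → Matrix ι ι ℝ) (w : ℝ) (t : ℕ) (j : ι) (s : ℕ) : Finset ι :=
  Finset.univ.filter fun i => w ^ s ≤ transition W t s i j

variable {W : ℕ → Matrix ι ι ℝ} {w : ℝ} {B : ℕ}

lemma mem_reached {t s : ℕ} {i j : ι} : i ∈ reached W w t j s ↔ w ^ s ≤ transition W t s i j := by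
  simp [reached]

lemma exists_exiting_step {α : Type*} {r : α → α → Prop} {S : Set α} {a b : α}
    (h : Relation.ReflTransGen r a b) (ha : a ∈ S) (hb : b ∉ S) : ∃ x ∈ S, ∃ y ∉ S, r x y := by
  by_contra! closed
  exact hb (h.rec ha fun _ hxy hx => by_contra fun hy => closed _ hx _ hy hxy)

namespace IsConsensusNetwork

variable (hW : IsConsensusNetwork W w B) {t : ℕ} (ht : 1 ≤ t)

include hW ht

lemma transition_mem_doublyStochastic (s : ℕ) : transition W t s ∈ doublyStochastic ℝ ι := by
  induction s with
  | zero => exact one_mem _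
  | succ s ih => exact mul_mem (hW.mem_doublyStochastic _ (Nat.le_add_right_of_le ht)) ih

lemma mem_reached_succ {s : ℕ} {i j k : ι} (hk : k ∈ reached W w t j s)
    (hik : w ≤ W (t + s) i k) : i ∈ reached W w t j (s + 1) := by
  rw [mem_reached] at hk ⊢
  have W_nonneg (l : ι) : 0 ≤ W (t + s) i l :=
    nonneg_of_mem_doublyStochastic (hW.mem_doublyStochastic _ (Nat.le_add_right_of_le ht))
  have transition_nonneg (l : ι) : 0 ≤ transition W t s l j :=
    nonneg_of_mem_doublyStochastic (hW.transition_mem_doublyStochastic ht s)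
  calc w ^ (s + 1) = w * w ^ s := pow_succ' w s
    _ ≤ W (t + s) i k * transition W t s k j :=
        mul_le_mul hik hk (pow_nonneg hW.weight_pos.le s) (W_nonneg k)
    _ ≤ ∑ l, W (t + s) i l * transition W t s l j :=
        Finset.single_le_sum (f := fun l => W (t + s) i l * transition W t s l j)
          (fun l _ => mul_nonneg (W_nonneg l) (transition_nonneg l)) (Finset.mem_univ k)
    _ = transition W t (s + 1) i j := by rw [transition, Matrix.mul_apply]

lemma reached_monotone (j : ι) : Monotone (reached W w t j) :=
  monotone_nat_of_le_succ fun _ i hi =>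
    hW.mem_reached_succ ht hi (hW.le_diag _ (Nat.le_add_right_of_le ht) i)

lemma self_mem_reached (j : ι) (s : ℕ) : j ∈ reached W w t j s :=
  hW.reached_monotone ht j s.zero_le (by simp [mem_reached, transition])

lemma reached_ssubset {j : ι} {s : ℕ} (h : reached W w t j s ≠ Finset.univ) :
    reached W w t j s ⊂ reached W w t j (s + B) := by
  obtain ⟨b, hb⟩ : ∃ b, b ∉ reached W w t j s := by
    simpa [Finset.eq_univ_iff_forall] using h
  obtain ⟨x, hx, y, hy, l, hl, hxy⟩ :=
    exists_exiting_step (S := (reached W w t j s : Set ι))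
      (hW.jointly_connected (t + s) (Nat.le_add_right_of_le ht) j b)
      (hW.self_mem_reached ht j s) hb
  have hx' : x ∈ reached W w t j (s + l) := hW.reached_monotone ht j (Nat.le_add_right s l) hx
  have hy' : y ∈ reached W w t j (s + l + 1) :=
    hW.mem_reached_succ ht hx' (by rwa [← add_assoc])
  exact Finset.ssubset_iff_of_subset (hW.reached_monotone ht j (Nat.le_add_right s B)) |>.2
    ⟨y, hW.reached_monotone ht j (by omega) hy', hy⟩

lemma min_card_le_card_reached (j : ι) (k : ℕ) :
    min (Fintype.card ι) k ≤ (reached W w t j (k * B)).card := by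
  induction k with
  | zero => simp
  | succ k ih =>
    rw [Nat.succ_mul]
    by_cases h : reached W w t j (k * B) = Finset.univ
    · have full : reached W w t j (k * B + B) = Finset.univ :=
        Finset.univ_subset_iff.1 (h ▸ hW.reached_monotone ht j (Nat.le_add_right (k * B) B))
      simp [full]
    · have := Finset.card_lt_card (hW.reached_ssubset ht h)
      omega

lemma pow_le_transition (i j : ι) :
    w ^ (Fintype.card ι * B) ≤ transition W t (Fintype.card ι * B) i j := by
  have card_le := hW.min_card_le_card_reached ht j (Fintype.card ι)
  rw [min_self] at card_le
  exact mem_reached.1 (Finset.eq_univ_iff_forall.1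
    (Finset.card_eq_iff_eq_univ _ |>.1 (le_antisymm (Finset.card_le_univ _) card_le)) i)

lemma card_mul_pow_le_one [Nonempty ι] : Fintype.card ι * w ^ (Fintype.card ι * B) ≤ 1 := by
  obtain ⟨i⟩ := ‹Nonempty ι›
  rw [← sum_row_of_mem_doublyStochastic
    (hW.transition_mem_doublyStochastic ht (Fintype.card ι * B)) i]
  simpa using Finset.sum_le_sum fun j (_ : j ∈ Finset.univ) => hW.pow_le_transition ht i j

end IsConsensusNetwork

variable {E : Type*} [NormedAddCommGroup E] [NormedSpace ℝ E]

namespace IsConsensusNetwork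

variable (hW : IsConsensusNetwork W w B)

include hW

lemma deviation_sub_mix_transition_le (v : ℕ → ι → E) {t : ℕ} (ht : 1 ≤ t) (s : ℕ) :
    deviation (v (t + s) - mix (transition W t s) (v t)) ≤
      ∑ k ∈ Finset.range s, 2 * mixingDefect W v (t + k) := by
  induction s with
  | zero => simp [transition, mix_one, deviation, mean]
  | succ s ih =>
    have recursion : v (t + (s + 1)) - mix (transition W t (s + 1)) (v t) =
        mix (W (t + s)) (v (t + s) - mix (transition W t s) (v t)) +
          (v (t + s + 1) - mix (W (t + s)) (v (t + s))) := by
      rw [transition, mix_mul, ← add_assoc t s 1, eq_sub_of_add_eq (mix_add (W (t + s))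
        (v (t + s) - mix (transition W t s) (v t)) (mix (transition W t s) (v t))).symm,
        sub_add_cancel]
      abel
    rw [recursion, Finset.sum_range_succ]
    exact (deviation_add_le _ _).trans (add_le_add
      ((deviation_mix_le_self (hW.mem_doublyStochastic _ (Nat.le_add_right_of_le ht)) _).trans ih)
      (deviation_le_two_mul_sum_norm _))

lemma deviation_add_card_mul_le (v : ℕ → ι → E) {t : ℕ} (ht : 1 ≤ t) :
    deviation (v (t + Fintype.card ι * B)) ≤
      (1 - Fintype.card ι * w ^ (Fintype.card ι * B)) * deviation (v t) +
        ∑ k ∈ Finset.range (Fintype.card ι * B), 2 * mixingDefect W v (t + k) := by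
  rw [← add_sub_cancel (mix (transition W t (Fintype.card ι * B)) (v t))
    (v (t + Fintype.card ι * B))]
  exact (deviation_add_le _ _).trans (add_le_add
    (deviation_mix_le (hW.transition_mem_doublyStochastic ht _) (hW.pow_le_transition ht) _)
    (hW.deviation_sub_mix_transition_le v ht _))

lemma sum_deviation_le {R : ℝ} (hR : 0 ≤ R) {T : ℕ} (v : ℕ → ι → E)
    (hv : ∀ t, 1 ≤ t → t ≤ T → ∀ i, ‖v t i‖ ≤ R) :
    Fintype.card ι * w ^ (Fintype.card ι * B) * ∑ t ∈ Finset.Icc 1 T, deviation (v t) ≤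
      2 * (Fintype.card ι * B : ℕ) * (Fintype.card ι * R +
        ∑ t ∈ Finset.Ico 1 T, mixingDefect W v t) := by
  cases isEmpty_or_nonempty ι
  · simp [deviation]
  have deviation_le (t : ℕ) (h1 : 1 ≤ t) (hT : t ≤ T) :
      deviation (v t) ≤ 2 * (Fintype.card ι * R) := by
    refine (deviation_le_two_mul_sum_norm _).trans (mul_le_mul_of_nonneg_left ?_ zero_le_two)
    simpa using Finset.sum_le_sum fun i (_ : i ∈ Finset.univ) => hv t h1 hT i
  have contraction := sum_le_of_contraction (fun t => deviation_nonneg (v t))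
    (fun t => mul_nonneg zero_le_two (mixingDefect_nonneg W v t))
    (sub_nonneg.2 (hW.card_mul_pow_le_one le_rfl)) (by positivity) deviation_le
    fun t ht => hW.deviation_add_card_mul_le v ht
  rw [← Finset.mul_sum] at contraction
  linarith

end IsConsensusNetwork

lemma Problem.RegularNetwork.isConsensusNetwork {n p : ℕ} {m : Fin n → ℕ} {P : Problem n p m}
    (hN : P.RegularNetwork w B) (hw : 0 < w) : IsConsensusNetwork P.W w B := by
  have le_W {t : ℕ} (ht : 1 ≤ t) {i j : Fin n} (h : (P.graph t).Adj j i ∨ i = j) : w ≤ P.W t i j :=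
    hN.weight_lower t ht i j (hN.weight_pos t ht i j h)
  refine ⟨hw, fun t ht => ?_, fun t ht i => le_W ht (Or.inr rfl), fun t ht i j => ?_⟩
  · refine mem_doublyStochastic_iff_sum.2 ⟨fun i j => ?_, hN.row_sum t ht, hN.col_sum t ht⟩
    by_cases h : (P.graph t).Adj j i ∨ i = j
    · exact (hN.weight_pos t ht i j h).le
    · exact (hN.weight_zero t ht i j h).ge
  · exact Relation.ReflTransGen.mono (fun a b ⟨l, hl, hab⟩ =>
      ⟨l, hl, le_W (Nat.le_add_right_of_le ht) (Or.inl hab)⟩) _ _ (hN.jointly_connected t ht i j)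

end Consensus

section NonnegativeOrthant

variable {ι : Type}

@[simp] lemma nonnegPart_apply (v : EuclideanSpace ℝ ι) (k : ι) :
    nonnegPart v k = max (v k) 0 := rfl

lemma nonnegPart_apply_nonneg (v : EuclideanSpace ℝ ι) (k : ι) : 0 ≤ nonnegPart v k :=
  le_max_right _ _

lemma nonnegPart_of_nonneg {v : EuclideanSpace ℝ ι} (hv : ∀ k, 0 ≤ v k) : nonnegPart v = v := by
  ext k; exact max_eq_left (hv k)

lemma nonnegPart_of_nonpos {v : EuclideanSpace ℝ ι} (hv : ∀ k, v k ≤ 0) : nonnegPart v = 0 := by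
  ext k; exact max_eq_right (hv k)

variable [Fintype ι]

lemma norm_le_norm_of_abs_le_abs {u v : EuclideanSpace ℝ ι} (h : ∀ k, |u k| ≤ |v k|) :
    ‖u‖ ≤ ‖v‖ := by
  simp only [EuclideanSpace.norm_eq, Real.norm_eq_abs, sq_abs]
  exact Real.sqrt_le_sqrt (Finset.sum_le_sum fun k _ => sq_le_sq.2 (h k))

lemma norm_le_norm_of_nonneg_of_le {u v : EuclideanSpace ℝ ι} (hu : ∀ k, 0 ≤ u k)
    (h : ∀ k, u k ≤ v k) : ‖u‖ ≤ ‖v‖ :=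
  norm_le_norm_of_abs_le_abs fun k => abs_le_abs_of_nonneg (hu k) (h k)

lemma norm_nonnegPart_sub_nonnegPart_le (u v : EuclideanSpace ℝ ι) :
    ‖nonnegPart u - nonnegPart v‖ ≤ ‖u - v‖ :=
  norm_le_norm_of_abs_le_abs fun k => abs_max_sub_max_le_abs (u k) (v k) 0

lemma norm_nonnegPart_le (v : EuclideanSpace ℝ ι) : ‖nonnegPart v‖ ≤ ‖v‖ := by
  simpa only [nonnegPart_of_nonpos (v := (0 : EuclideanSpace ℝ ι)) fun _ => le_rfl, sub_zero] using
    norm_nonnegPart_sub_nonnegPart_le v 0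

lemma norm_nonnegPart_sub_le (v : EuclideanSpace ℝ ι) {u : EuclideanSpace ℝ ι}
    (hu : ∀ k, 0 ≤ u k) : ‖nonnegPart v - u‖ ≤ ‖v - u‖ := by
  simpa only [nonnegPart_of_nonneg hu] using norm_nonnegPart_sub_nonnegPart_le v u

lemma inner_nonneg_of_nonneg {u v : EuclideanSpace ℝ ι} (hu : ∀ k, 0 ≤ u k) (hv : ∀ k, 0 ≤ v k) :
    0 ≤ inner ℝ u v := by
  rw [PiLp.inner_apply]
  exact Finset.sum_nonneg fun k _ => mul_nonneg (hv k) (hu k)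

lemma inner_le_inner_of_nonneg_left {u v v' : EuclideanSpace ℝ ι} (hu : ∀ k, 0 ≤ u k)
    (hv : ∀ k, v k ≤ v' k) : inner ℝ u v ≤ inner ℝ u v' := by
  rw [← sub_nonneg, ← inner_sub_right]
  exact inner_nonneg_of_nonneg hu fun k => sub_nonneg.2 (hv k)

lemma norm_le_sum_abs (v : EuclideanSpace ℝ ι) : ‖v‖ ≤ ∑ k, |v k| := by
  rw [EuclideanSpace.norm_eq]
  exact Real.sqrt_le_iff.2 ⟨Finset.sum_nonneg fun _ _ => abs_nonneg _,
    Finset.sum_sq_le_sq_sum_of_nonneg fun _ _ => abs_nonneg _⟩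

/-- The vector all of whose coordinates are `r`; as a dual vector it penalizes the violations of
all constraints equally. -/
noncomputable def constVec (ι : Type) (r : ℝ) : EuclideanSpace ℝ ι := WithLp.toLp 2 fun _ => r

lemma norm_constVec_le {r : ℝ} (hr : 0 ≤ r) : ‖constVec ι r‖ ≤ Fintype.card ι * r :=
  (norm_le_sum_abs _).trans_eq (by simp [constVec, abs_of_nonneg hr])

lemma mul_norm_le_inner_constVec {r : ℝ} (hr : 0 ≤ r) {v : EuclideanSpace ℝ ι}
    (hv : ∀ k, 0 ≤ v k) : r * ‖v‖ ≤ inner ℝ (constVec ι r) v := by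
  refine (mul_le_mul_of_nonneg_left (norm_le_sum_abs v) hr).trans_eq ?_
  simp [PiLp.inner_apply, constVec, Finset.mul_sum, abs_of_nonneg (hv _), mul_comm]

end NonnegativeOrthant

section Projection

variable {d : ℕ} {K : Set (Vec d)}

lemma IsProjection.inner_le_zero (hK : Convex ℝ K) {u x : Vec d} (h : IsProjection K u x)
    {y : Vec d} (hy : y ∈ K) : inner ℝ (u - x) (y - x) ≤ 0 := by
  refine (norm_eq_iInf_iff_real_inner_le_zero hK h.1).1 ?_ y hy
  have : Nonempty K := ⟨⟨x, h.1⟩⟩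
  refine le_antisymm (le_ciInf fun y => ?_) ?_
  · exact (sq_le_sq₀ (norm_nonneg _) (norm_nonneg _)).1 (h.2 y y.2)
  · exact ciInf_le (f := fun w : K => ‖u - w‖)
      ⟨0, by rintro _ ⟨w, rfl⟩; exact norm_nonneg _⟩ ⟨x, h.1⟩

lemma IsProjection.inner_direction_le (hK : Convex ℝ K) {z ω x' y : Vec d} {α : ℝ} (hα : 0 < α)
    (h : IsProjection K (z - α • ω) x') (hy : y ∈ K) :
    inner ℝ ω (x' - y) ≤ (‖z - y‖ ^ 2 - ‖x' - y‖ ^ 2 - ‖x' - z‖ ^ 2) / (2 * α) := by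
  have optimality := h.inner_le_zero hK hy
  have three_points :
      ‖z - y‖ ^ 2 = ‖x' - z‖ ^ 2 + 2 * inner ℝ (z - x') (x' - y) + ‖x' - y‖ ^ 2 := by
    rw [norm_sub_rev x' z, ← norm_add_sq_real, sub_add_sub_cancel]
  rw [sub_right_comm, inner_sub_left, real_inner_smul_left, ← neg_sub x' y, inner_neg_right,
    inner_neg_right] at optimality
  rw [le_div_iff₀ (by positivity)]
  linarith

end Projection

section Subgradients

lemma norm_adjoint_apply_le {E₁ E₂ : Type*} [NormedAddCommGroup E₁] [InnerProductSpace ℝ E₁]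
    [CompleteSpace E₁] [NormedAddCommGroup E₂] [InnerProductSpace ℝ E₂] [CompleteSpace E₂]
    {G : E₁ →L[ℝ] E₂} {F : ℝ} (hG : ‖G‖ ≤ F) (v : E₂) :
    ‖ContinuousLinearMap.adjoint G v‖ ≤ F * ‖v‖ :=
  (ContinuousLinearMap.adjoint G).le_of_opNorm_le (by rwa [LinearIsometryEquiv.norm_map]) v

variable {d k : ℕ} {K : Set (Vec d)} {x x' y : Vec d} {F : ℝ}

lemma adjoint_apply_apply (G : Vec k →L[ℝ] Vec d) (v : Vec d) (l : Fin k) :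
    ContinuousLinearMap.adjoint G v l = inner ℝ (G (EuclideanSpace.single l 1)) v := by
  rw [← ContinuousLinearMap.adjoint_inner_right, EuclideanSpace.inner_single_left]
  simp

lemma map_eq_sum_smul_single {E : Type*} [NormedAddCommGroup E] [NormedSpace ℝ E]
    (H : Vec k →L[ℝ] E) (v : Vec k) :
    H v = ∑ l, v l • H (EuclideanSpace.single l 1) := by
  conv_lhs => rw [← (EuclideanSpace.basisFun (Fin k) ℝ).sum_repr v]
  simp [map_sum]

lemma norm_le_of_columns_eq_smul {G H : Vec k →L[ℝ] Vec d} (hG : ‖G‖ ≤ F)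
    (h : ∀ l, ∃ θ ∈ Set.Icc (0 : ℝ) 1,
      H (EuclideanSpace.single l 1) = θ • G (EuclideanSpace.single l 1)) : ‖H‖ ≤ F := by
  choose θ hθ hH using h
  refine H.opNorm_le_bound ((norm_nonneg _).trans hG) fun v => ?_
  have scaled : H v = G (WithLp.toLp 2 fun l => v l * θ l) := by
    rw [map_eq_sum_smul_single H, map_eq_sum_smul_single G]
    simp only [hH, smul_smul]
  rw [scaled]
  refine (G.le_of_opNorm_le hG _).trans
    (mul_le_mul_of_nonneg_left ?_ ((norm_nonneg _).trans hG))
  refine norm_le_norm_of_abs_le_abs fun l => ?_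
  rw [abs_mul, abs_of_nonneg (hθ l).1]
  exact mul_le_of_le_one_right (abs_nonneg _) (hθ l).2

lemma IsSubgradient.sub_le {f : Vec d → ℝ} {v : Vec d} (hv : IsSubgradient K f x v)
    (hvF : ‖v‖ ≤ F) (hy : y ∈ K) (x' : Vec d) :
    f x - f y ≤ inner ℝ v (x' - y) + F * ‖x' - x‖ := by
  have subgradient := hv y hy
  have displacement : -(F * ‖x' - x‖) ≤ inner ℝ v (x' - x) :=
    (neg_le_neg (mul_le_mul_of_nonneg_right hvF (norm_nonneg _))).trans
      (neg_le_of_abs_le (abs_real_inner_le_norm v (x' - x)))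
  rw [← sub_sub_sub_cancel_right x' y x, inner_sub_right]
  linarith

/-- The linearization of `[g]₊` at `x`, evaluated at `x'`, where `G` is a subgradient matrix
at `x`; it drives the dual update. -/
noncomputable def linearizedViolation (g : Vec d → Vec k) (G : Vec k →L[ℝ] Vec d)
    (x x' : Vec d) : Vec k :=
  nonnegPart (g x) + ContinuousLinearMap.adjoint G (x' - x)

variable {g : Vec d → Vec k} {G : Vec k →L[ℝ] Vec d}

lemma linearizedViolation_apply_le
    (hG : IsSubgradientMatrix K (fun y => nonnegPart (g y)) x G) (hx' : x' ∈ K) (l : Fin k) :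
    linearizedViolation g G x x' l ≤ nonnegPart (g x') l := by
  simpa only [linearizedViolation, PiLp.add_apply, adjoint_apply_apply] using hG l x' hx'

lemma norm_linearizedViolation_le (hGF : ‖G‖ ≤ F) (x x' : Vec d) :
    ‖linearizedViolation g G x x'‖ ≤ ‖g x‖ + F * ‖x' - x‖ :=
  (norm_add_le _ _).trans (add_le_add (norm_nonnegPart_le _) (norm_adjoint_apply_le hGF _))

lemma norm_nonnegPart_le_add (hG : IsSubgradientMatrix K (fun y => nonnegPart (g y)) x G)
    (hGF : ‖G‖ ≤ F) (hy : y ∈ K) :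
    ‖nonnegPart (g x)‖ ≤ ‖nonnegPart (g y)‖ + F * ‖x - y‖ := by
  have coordinatewise (l : Fin k) : nonnegPart (g x) l ≤
      (nonnegPart (g y) + ContinuousLinearMap.adjoint G (x - y)) l := by
    have := hG l y hy
    rw [← neg_sub x y, inner_neg_right, ← adjoint_apply_apply] at this
    rw [PiLp.add_apply]
    linarith
  calc ‖nonnegPart (g x)‖ ≤ ‖nonnegPart (g y) + ContinuousLinearMap.adjoint G (x - y)‖ :=
        norm_le_norm_of_nonneg_of_le (nonnegPart_apply_nonneg _) coordinatewise
    _ ≤ ‖nonnegPart (g y)‖ + F * ‖x - y‖ :=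
        (norm_add_le _ _).trans (add_le_add_right (norm_adjoint_apply_le hGF _) _)

lemma inner_linearizedViolation_le {q : Vec k} (hq : ∀ l, 0 ≤ q l)
    (hG : IsSubgradientMatrix K (fun y => nonnegPart (g y)) x G) (hy : y ∈ K)
    (hgy : ∀ l, g y l ≤ 0) (x' : Vec d) :
    inner ℝ q (linearizedViolation g G x x') ≤ inner ℝ (G q) (x' - y) := by
  have feasible : inner ℝ q (linearizedViolation g G x y) ≤ 0 := by
    refine (inner_le_inner_of_nonneg_left hq (linearizedViolation_apply_le hG hy)).trans_eq ?_
    rw [nonnegPart_of_nonpos hgy, inner_zero_right]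
  rw [linearizedViolation, inner_add_right, ContinuousLinearMap.adjoint_inner_right]
    at feasible ⊢
  rw [← sub_sub_sub_cancel_right x' y x, inner_sub_right (G q) (x' - x)]
  linarith

lemma inner_nonnegPart_sub_le_inner_linearizedViolation (hGF : ‖G‖ ≤ F) (μ : Vec k)
    (x x' : Vec d) :
    inner ℝ μ (nonnegPart (g x)) - F * ‖μ‖ * ‖x' - x‖ ≤
      inner ℝ μ (linearizedViolation g G x x') := by
  have correction : -(‖μ‖ * (F * ‖x' - x‖)) ≤
      inner ℝ μ (ContinuousLinearMap.adjoint G (x' - x)) :=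
    (neg_le_neg (mul_le_mul_of_nonneg_left (norm_adjoint_apply_le hGF _) (norm_nonneg μ))).trans
      (neg_le_of_abs_le (abs_real_inner_le_norm _ _))
  rw [linearizedViolation, inner_add_right]
  linarith

end Subgradients

section OneStep

variable {d k : ℕ} {K : Set (Vec d)} {f : Vec d → ℝ} {g : Vec d → Vec k} {x x' y z sf : Vec d}
  {q μ : Vec k} {G : Vec k →L[ℝ] Vec d} {F C α β γ : ℝ}

lemma norm_dual_step_le (hG : IsSubgradientMatrix K (fun y => nonnegPart (g y)) x G)
    (hx' : x' ∈ K) (hg : ‖g x'‖ ≤ F) (hγ : 0 ≤ γ) (hβγ : β * γ ≤ 1) (hq : ∀ l, 0 ≤ q l) :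
    ‖nonnegPart ((1 - β * γ) • q + γ • linearizedViolation g G x x')‖ ≤
      (1 - β * γ) * ‖q‖ + γ * F := by
  have hs : 0 ≤ 1 - β * γ := sub_nonneg.2 hβγ
  calc ‖nonnegPart ((1 - β * γ) • q + γ • linearizedViolation g G x x')‖
      ≤ ‖(1 - β * γ) • q + γ • nonnegPart (g x')‖ := by
        refine norm_le_norm_of_nonneg_of_le (nonnegPart_apply_nonneg _) fun l => max_le ?_ ?_
        · exact add_le_add_right
            (mul_le_mul_of_nonneg_left (linearizedViolation_apply_le hG hx' l) hγ) _
        · exact add_nonneg (mul_nonneg hs (hq l))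
            (mul_nonneg hγ (nonnegPart_apply_nonneg _ l))
    _ ≤ (1 - β * γ) * ‖q‖ + γ * ‖nonnegPart (g x')‖ := by
        refine (norm_add_le _ _).trans_eq ?_
        rw [norm_smul, norm_smul, Real.norm_of_nonneg hs, Real.norm_of_nonneg hγ]
    _ ≤ (1 - β * γ) * ‖q‖ + γ * F := by
        gcongr
        exact (norm_nonnegPart_le _).trans hg

lemma dual_step_sub_le {b : Vec k} (hγ : 0 < γ) (hβ : 0 ≤ β) (hμ : ∀ l, 0 ≤ μ l)
    (hb : ‖b - β • q‖ ≤ C) :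
    (‖nonnegPart ((1 - β * γ) • q + γ • b) - μ‖ ^ 2 - (1 - β * γ) * ‖q - μ‖ ^ 2) / (2 * γ) ≤
      γ / 2 * C ^ 2 + inner ℝ q b - inner ℝ μ b + β / 2 * ‖μ‖ ^ 2 := by
  have nonexpansive :
      ‖nonnegPart ((1 - β * γ) • q + γ • b) - μ‖ ^ 2 ≤ ‖(q - μ) + γ • (b - β • q)‖ ^ 2 := by
    refine pow_le_pow_left₀ (norm_nonneg _) ((norm_nonnegPart_sub_le _ hμ).trans_eq ?_) 2
    congr 1
    module
  have expansion : ‖(q - μ) + γ • (b - β • q)‖ ^ 2 =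
      ‖q - μ‖ ^ 2 + 2 * γ * (inner ℝ q b - inner ℝ μ b) - 2 * γ * β * inner ℝ (q - μ) q
        + γ ^ 2 * ‖b - β • q‖ ^ 2 := by
    rw [norm_add_sq_real, norm_smul, mul_pow, Real.norm_eq_abs, sq_abs]
    simp only [inner_smul_right, inner_sub_right, inner_sub_left]
    ring
  have polarization : 2 * inner ℝ (q - μ) q = ‖q‖ ^ 2 + ‖q - μ‖ ^ 2 - ‖μ‖ ^ 2 := by
    have := norm_sub_sq_real q (q - μ)
    rw [sub_sub_cancel, real_inner_comm] at this
    linarith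
  have regularized_le : γ ^ 2 * ‖b - β • q‖ ^ 2 ≤ γ ^ 2 * C ^ 2 := by gcongr
  have dropped : 0 ≤ β * γ * ‖q‖ ^ 2 := by positivity
  rw [div_le_iff₀ (by positivity)]
  linear_combination nonexpansive + expansion + regularized_le + dropped - γ * β * polarization

/-- The dual update contributes `⟪q, b⟫ - ⟪μ, b⟫` with `b` the linearized violation: the first
term cancels against the penalty in the primal direction, the second one is the violation. -/
lemma primal_dual_step_le (hK : Convex ℝ K) (hy : y ∈ K) (hgy : ∀ l, g y l ≤ 0)
    (hsf : IsSubgradient K f x sf) (hsfF : ‖sf‖ ≤ F)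
    (hG : IsSubgradientMatrix K (fun y => nonnegPart (g y)) x G) (hGF : ‖G‖ ≤ F)
    (hq : ∀ l, 0 ≤ q l) (hμ : ∀ l, 0 ≤ μ l) (hα : 0 < α) (hβ : 0 ≤ β) (hγ : 0 < γ)
    (hC : ‖linearizedViolation g G x x' - β • q‖ ≤ C)
    (hx' : IsProjection K (z - α • (sf + G q)) x') :
    f x - f y + inner ℝ μ (nonnegPart (g x)) + ‖x' - z‖ ^ 2 / (2 * α) +
        (‖nonnegPart ((1 - β * γ) • q + γ • linearizedViolation g G x x') - μ‖ ^ 2 -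
          (1 - β * γ) * ‖q - μ‖ ^ 2) / (2 * γ) ≤
      γ / 2 * C ^ 2 + β / 2 * ‖μ‖ ^ 2 + F * (1 + ‖μ‖) * ‖x' - x‖ +
        (‖z - y‖ ^ 2 - ‖x' - y‖ ^ 2) / (2 * α) := by
  have primal := hx'.inner_direction_le hK hα hy
  rw [inner_add_left, sub_div] at primal
  linarith [dual_step_sub_le hγ hβ hμ hC, hsf.sub_le hsfF hy x',
    inner_linearizedViolation_le hq hG hy hgy x',
    inner_nonnegPart_sub_le_inner_linearizedViolation (g := g) hGF μ x x']

end OneStep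

section FamiliesOfVectors

variable {ι E : Type*} [Fintype ι] [NormedAddCommGroup E] [NormedSpace ℝ E]

lemma sum_norm_mix_sub_sq_le [DecidableEq ι] {M : Matrix ι ι ℝ} (hM : M ∈ doublyStochastic ℝ ι)
    (v : ι → E) (a : E) : ∑ i, ‖mix M v i - a‖ ^ 2 ≤ ∑ j, ‖v j - a‖ ^ 2 := by
  have hM₀ (i j : ι) : 0 ≤ M i j := nonneg_of_mem_doublyStochastic hM
  have jensen (i : ι) : ‖mix M v i - a‖ ^ 2 ≤ ∑ j, M i j * ‖v j - a‖ ^ 2 := by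
    refine le_trans ?_ (Real.pow_arith_mean_le_arith_mean_pow Finset.univ (M i)
      (fun j => ‖v j - a‖) (fun j _ => hM₀ i j) (sum_row_of_mem_doublyStochastic hM i)
      (fun j _ => norm_nonneg _) 2)
    rw [mix_sub_const hM]
    refine pow_le_pow_left₀ (norm_nonneg _) ((norm_sum_le _ _).trans_eq ?_) 2
    exact Finset.sum_congr rfl fun j _ => by rw [norm_smul, Real.norm_of_nonneg (hM₀ i j)]
  calc ∑ i, ‖mix M v i - a‖ ^ 2 ≤ ∑ i, ∑ j, M i j * ‖v j - a‖ ^ 2 :=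
        Finset.sum_le_sum fun i _ => jensen i
    _ = ∑ j, ‖v j - a‖ ^ 2 := by
        rw [Finset.sum_comm]
        simp_rw [← Finset.sum_mul, sum_col_of_mem_doublyStochastic hM, one_mul]

lemma sum_sum_norm_sub_le {u v : ι → E} {ε : ℝ} (h : ∀ i, ‖v i - u i‖ ≤ ε) :
    ∑ i, ∑ j, ‖u i - u j‖ ≤ 2 * Fintype.card ι * (deviation v + Fintype.card ι * ε) := by
  have to_mean (i : ι) : ‖mean v - u i‖ ≤ ‖v i - mean v‖ + ε := by
    rw [← norm_sub_rev (mean v)]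
    exact (norm_sub_le_norm_sub_add_norm_sub _ (v i) _).trans (add_le_add_right (h i) _)
  calc ∑ i, ∑ j, ‖u i - u j‖
      ≤ ∑ i, ∑ j, ((‖v i - mean v‖ + ε) + (‖v j - mean v‖ + ε)) := by
        refine Finset.sum_le_sum fun i _ => Finset.sum_le_sum fun j _ => ?_
        refine (norm_sub_le_norm_sub_add_norm_sub _ (mean v) _).trans
          (add_le_add ?_ (to_mean j))
        exact norm_sub_rev (u i) _ ▸ to_mean i
    _ = 2 * Fintype.card ι * (deviation v + Fintype.card ι * ε) := by
        simp only [Finset.sum_add_distrib, Finset.sum_const, Finset.card_univ, nsmul_eq_mul,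
          deviation, ← Finset.mul_sum]
        ring

end FamiliesOfVectors

section Trajectories

variable {n p : ℕ} {m : Fin n → ℕ} {P : Problem n p m} {F₁ F₂ R w : ℝ} {B T t : ℕ}
  {α β γ τ : ℕ → ℝ} {S : Trajectory n p m}

/-- What the analysis needs to know about the step sizes `α`, `β` and the regularization
parameters `γ`; the last condition makes the dual terms telescope. -/
structure AdmissibleStepSizes (α β γ : ℕ → ℝ) : Prop where
  alpha_pos : ∀ t, 1 ≤ t → 0 < α t
  alpha_succ_le : ∀ t, 1 ≤ t → α (t + 1) ≤ α t
  beta_nonneg : ∀ t, 1 ≤ t → 0 ≤ β t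
  beta_succ_le : ∀ t, 1 ≤ t → β (t + 1) ≤ β t
  gamma_pos : ∀ t, 1 ≤ t → 0 < γ t
  beta_mul_gamma_le_one : ∀ t, 1 ≤ t → β t * γ t ≤ 1
  one_sub_div_gamma_succ_le : ∀ t, 1 ≤ t → (1 - β (t + 1) * γ (t + 1)) / γ (t + 1) ≤ 1 / γ t

namespace Problem.RegularData

lemma norm_sub_le_two_mul (hD : P.RegularData F₁ F₂ R) {x y : Vec p} (hx : x ∈ P.X)
    (hy : y ∈ P.X) : ‖x - y‖ ≤ 2 * R :=
  (norm_sub_le _ _).trans (by linarith [hD.bounded x hx, hD.bounded y hy])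

lemma norm_sub_sq_le_add (hD : P.RegularData F₁ F₂ R) {x x' y : Vec p} (hx : x ∈ P.X)
    (hx' : x' ∈ P.X) (hy : y ∈ P.X) : ‖x - y‖ ^ 2 ≤ ‖x' - y‖ ^ 2 + 4 * R * ‖x - x'‖ := by
  have bound : ‖x - y‖ + ‖x' - y‖ ≤ 4 * R := by
    linarith [hD.norm_sub_le_two_mul hx hy, hD.norm_sub_le_two_mul hx' hy]
  have triangle : ‖x - y‖ - ‖x' - y‖ ≤ ‖x - x'‖ := by
    simpa using norm_sub_norm_le (x - y) (x' - y)
  have : (‖x - y‖ + ‖x' - y‖) * (‖x - y‖ - ‖x' - y‖) ≤ 4 * R * ‖x - x'‖ :=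
    (mul_le_mul_of_nonneg_left triangle (by positivity)).trans
      (mul_le_mul_of_nonneg_right bound (norm_nonneg _))
  linarith

lemma norm_subgPos_le (hD : P.RegularData F₁ F₂ R) (hP : P.PosPartSubgradients) {i : Fin n}
    (ht : 1 ≤ t) {x : Vec p} (hx : x ∈ P.X) : ‖P.subgPos i t x‖ ≤ F₂ :=
  norm_le_of_columns_eq_smul (hD.subg_bound i t ht x hx) (hP.chain_rule i t ht x hx)

lemma f_le_add (hD : P.RegularData F₁ F₂ R) {i : Fin n} (ht : 1 ≤ t) {x y : Vec p}
    (hx : x ∈ P.X) (hy : y ∈ P.X) : P.f i t x ≤ P.f i t y + F₂ * ‖x - y‖ := by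
  have := (hD.subf_spec i t ht x hx).sub_le (hD.subf_bound i t ht x hx) hy y
  rw [sub_self, inner_zero_right, zero_add, norm_sub_rev] at this
  linarith

end Problem.RegularData

namespace IsGenerated

lemma x_mem (hS : IsGenerated P α β γ τ T S) (i : Fin n) (h1 : 1 ≤ t) (h2 : t ≤ T) :
    S.x i t ∈ P.X := by
  cases t, h1 using Nat.le_induction with
  | base => exact hS.init_x i
  | succ t h1 => exact (hS.step_x i t h1 h2).1

lemma xhat_mem (hS : IsGenerated P α β γ τ T S) (i : Fin n) (h1 : 1 ≤ t) (h2 : t ≤ T) :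
    S.xhat i t ∈ P.X := by
  induction t, h1 using Nat.le_induction with
  | base => exact hS.init_xhat i ▸ hS.init_x i
  | succ t h1 ih =>
    rw [hS.step_xhat i t h1 h2]
    split_ifs
    · exact hS.x_mem i (Nat.le_succ_of_le h1) h2
    · exact ih (Nat.le_of_lt h2)

lemma norm_xhat_sub_x_le (hS : IsGenerated P α β γ τ T S) (hτ : ∀ t, 0 ≤ τ t) (i : Fin n)
    (h1 : 1 ≤ t) (h2 : t ≤ T) : ‖S.xhat i t - S.x i t‖ ≤ τ t := by
  cases t, h1 using Nat.le_induction with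
  | base => simpa [hS.init_xhat i] using hτ 1
  | succ t h1 =>
    rw [hS.step_xhat i t h1 h2]
    split_ifs with h
    · simpa using hτ (t + 1)
    · rw [norm_sub_rev]
      exact (not_le.1 h).le

lemma q_nonneg (hS : IsGenerated P α β γ τ T S) (i : Fin n) (h1 : 1 ≤ t) (h2 : t ≤ T)
    (l : Fin (m i)) : 0 ≤ S.q i t l := by
  cases t, h1 using Nat.le_induction with
  | base => simp [hS.init_q i]
  | succ t h1 => simp [hS.step_q i t h1 h2]

lemma beta_mul_norm_q_le (hD : P.RegularData F₁ F₂ R) (hP : P.PosPartSubgradients) (hF₁ : 0 ≤ F₁)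
    (hA : AdmissibleStepSizes α β γ) (hS : IsGenerated P α β γ τ T S) (i : Fin n)
    (h1 : 1 ≤ t) (h2 : t ≤ T) : β t * ‖S.q i t‖ ≤ F₁ := by
  induction t, h1 using Nat.le_induction with
  | base => simpa [hS.init_q i] using hF₁
  | succ t h1 ih =>
    have ht : 1 ≤ t + 1 := Nat.le_succ_of_le h1
    have hx' := hS.x_mem i ht h2
    have hβγ := hA.beta_mul_gamma_le_one (t + 1) ht
    have step : ‖S.q i (t + 1)‖ ≤ (1 - β (t + 1) * γ (t + 1)) * ‖S.q i t‖ + γ (t + 1) * F₁ := by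
      rw [hS.step_q i t h1 h2]
      exact norm_dual_step_le (hP.isSubgradient i t h1 _ (hS.x_mem i h1 (Nat.le_of_lt h2))) hx'
        (hD.g_bound i t h1 _ hx') (hA.gamma_pos _ ht).le hβγ (hS.q_nonneg i h1 (Nat.le_of_lt h2))
    have previous : β (t + 1) * ‖S.q i t‖ ≤ F₁ :=
      (mul_le_mul_of_nonneg_right (hA.beta_succ_le t h1) (norm_nonneg _)).trans
        (ih (Nat.le_of_lt h2))
    calc β (t + 1) * ‖S.q i (t + 1)‖
        ≤ β (t + 1) * ((1 - β (t + 1) * γ (t + 1)) * ‖S.q i t‖ + γ (t + 1) * F₁) :=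
          mul_le_mul_of_nonneg_left step (hA.beta_nonneg _ ht)
      _ = (1 - β (t + 1) * γ (t + 1)) * (β (t + 1) * ‖S.q i t‖) +
            β (t + 1) * γ (t + 1) * F₁ := by ring
      _ ≤ (1 - β (t + 1) * γ (t + 1)) * F₁ + β (t + 1) * γ (t + 1) * F₁ :=
          add_le_add_left (mul_le_mul_of_nonneg_left previous (sub_nonneg.2 hβγ)) _
      _ = F₁ := by ring

lemma z_eq_mix (hS : IsGenerated P α β γ τ T S) (i : Fin n) (h1 : 1 ≤ t) (h2 : t < T) :
    S.z i (t + 1) = mix (P.W t) (fun j => S.xhat j t) i :=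
  hS.step_z i t h1 h2

end IsGenerated

/-- The sum of the lengths of all primal steps. -/
noncomputable def totalStep (S : Trajectory n p m) (T : ℕ) : ℝ :=
  ∑ t ∈ Finset.Ico 1 T, ∑ i, ‖S.x i (t + 1) - S.z i (t + 1)‖

/-- The sum of the squared lengths of all primal steps, weighted by the inverse step sizes. -/
noncomputable def stepEnergy (α : ℕ → ℝ) (S : Trajectory n p m) (T : ℕ) : ℝ :=
  ∑ t ∈ Finset.Ico 1 T, ∑ i, ‖S.x i (t + 1) - S.z i (t + 1)‖ ^ 2 / α (t + 1)

/-- The sum of all pairwise distances between the decisions of the agents. -/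
noncomputable def disagreement (S : Trajectory n p m) (T : ℕ) : ℝ :=
  ∑ t ∈ Finset.Icc 1 T, ∑ i, ∑ j, ‖S.x i t - S.x j t‖

/-- The total distance travelled by the decisions. -/
noncomputable def totalMovement (S : Trajectory n p m) (T : ℕ) : ℝ :=
  ∑ t ∈ Finset.Ico 1 T, ∑ i, ‖S.x i (t + 1) - S.x i t‖

lemma totalStep_nonneg (S : Trajectory n p m) (T : ℕ) : 0 ≤ totalStep S T :=
  Finset.sum_nonneg fun _ _ => Finset.sum_nonneg fun _ _ => norm_nonneg _

lemma disagreement_nonneg (S : Trajectory n p m) (T : ℕ) : 0 ≤ disagreement S T :=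
  Finset.sum_nonneg fun _ _ => Finset.sum_nonneg fun _ _ => Finset.sum_nonneg fun _ _ =>
    norm_nonneg _

lemma norm_le_sq_div_add {E : Type*} [SeminormedAddCommGroup E] (v : E) {a s : ℝ} (ha : 0 < a)
    (hs : 0 < s) : ‖v‖ ≤ ‖v‖ ^ 2 / a / s + s * a := by
  have amgm : 0 ≤ ((‖v‖ - s * a) ^ 2 + ‖v‖ * (s * a)) / (a * s) := by positivity
  have : ((‖v‖ - s * a) ^ 2 + ‖v‖ * (s * a)) / (a * s) = ‖v‖ ^ 2 / a / s + s * a - ‖v‖ := by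
    field_simp
    ring
  linarith

lemma stepEnergy_nonneg (hα : ∀ t, 1 ≤ t → 0 < α t) : 0 ≤ stepEnergy α S T :=
  Finset.sum_nonneg fun t _ => Finset.sum_nonneg fun _ _ =>
    div_nonneg (sq_nonneg _) (hα (t + 1) (Nat.le_add_left 1 t)).le

lemma totalStep_le_stepEnergy_div_add (hα : ∀ t, 1 ≤ t → 0 < α t) {s : ℝ} (hs : 0 < s) :
    totalStep S T ≤ stepEnergy α S T / s + s * (n * ∑ t ∈ Finset.Ico 1 T, α (t + 1)) := by
  calc totalStep S T ≤ ∑ t ∈ Finset.Ico 1 T, ∑ i : Fin n,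
          (‖S.x i (t + 1) - S.z i (t + 1)‖ ^ 2 / α (t + 1) / s + s * α (t + 1)) :=
        Finset.sum_le_sum fun t _ => Finset.sum_le_sum fun i _ =>
          norm_le_sq_div_add _ (hα (t + 1) (Nat.le_add_left 1 t)) hs
    _ = stepEnergy α S T / s + s * (n * ∑ t ∈ Finset.Ico 1 T, α (t + 1)) := by
        simp only [Finset.sum_add_distrib, stepEnergy, Finset.sum_div, Finset.sum_const,
          Finset.card_univ, Fintype.card_fin, nsmul_eq_mul, Finset.mul_sum, mul_left_comm]

namespace IsGenerated

lemma mixingDefect_xhat_le (hτ : ∀ t, 0 ≤ τ t) (hS : IsGenerated P α β γ τ T S) (h1 : 1 ≤ t)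
    (h2 : t < T) : mixingDefect P.W (fun t i => S.xhat i t) t ≤
      ∑ i, ‖S.x i (t + 1) - S.z i (t + 1)‖ + n * τ (t + 1) := by
  have through_x (i : Fin n) : ‖S.xhat i (t + 1) - mix (P.W t) (fun j => S.xhat j t) i‖ ≤
      ‖S.x i (t + 1) - S.z i (t + 1)‖ + τ (t + 1) := by
    rw [← hS.z_eq_mix i h1 h2, add_comm ‖_‖]
    exact (norm_sub_le_norm_sub_add_norm_sub _ (S.x i (t + 1)) _).trans
      (add_le_add_left (hS.norm_xhat_sub_x_le hτ i (Nat.le_succ_of_le h1) h2) _)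
  calc mixingDefect P.W (fun t i => S.xhat i t) t
      ≤ ∑ i, (‖S.x i (t + 1) - S.z i (t + 1)‖ + τ (t + 1)) :=
        Finset.sum_le_sum fun i _ => through_x i
    _ = ∑ i, ‖S.x i (t + 1) - S.z i (t + 1)‖ + n * τ (t + 1) := by
        simp [Finset.sum_add_distrib]

lemma sum_deviation_xhat_le (hD : P.RegularData F₁ F₂ R) (hN : P.RegularNetwork w B)
    (hw : 0 < w) (hR : 0 ≤ R) (hτ : ∀ t, 0 ≤ τ t) (hS : IsGenerated P α β γ τ T S) :
    n * w ^ (n * B) * ∑ t ∈ Finset.Icc 1 T, deviation (fun i => S.xhat i t) ≤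
      2 * (n * B : ℕ) * (n * R + (totalStep S T + n * ∑ t ∈ Finset.Icc 1 T, τ t)) := by
  have defect : ∑ t ∈ Finset.Ico 1 T, mixingDefect P.W (fun t i => S.xhat i t) t ≤
      totalStep S T + n * ∑ t ∈ Finset.Icc 1 T, τ t :=
    calc ∑ t ∈ Finset.Ico 1 T, mixingDefect P.W (fun t i => S.xhat i t) t
        ≤ ∑ t ∈ Finset.Ico 1 T, (∑ i, ‖S.x i (t + 1) - S.z i (t + 1)‖ + n * τ (t + 1)) :=
          Finset.sum_le_sum fun t ht =>
            hS.mixingDefect_xhat_le hτ (Finset.mem_Ico.1 ht).1 (Finset.mem_Ico.1 ht).2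
      _ = totalStep S T + n * ∑ t ∈ Finset.Ico 1 T, τ (t + 1) := by
          rw [Finset.sum_add_distrib, ← Finset.mul_sum, totalStep]
      _ ≤ totalStep S T + n * ∑ t ∈ Finset.Icc 1 T, τ t := by
          gcongr
          exact sum_Ico_succ_le_sum_Icc hτ T
  have consensus := (hN.isConsensusNetwork hw).sum_deviation_le hR (T := T)
    (fun t i => S.xhat i t) fun t h1 h2 i => hD.bounded _ (hS.xhat_mem i h1 h2)
  rw [Fintype.card_fin] at consensus
  exact consensus.trans (by gcongr)

lemma disagreement_le (hτ : ∀ t, 0 ≤ τ t) (hS : IsGenerated P α β γ τ T S) :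
    disagreement S T ≤ 2 * n * (∑ t ∈ Finset.Icc 1 T, deviation (fun i => S.xhat i t) +
      n * ∑ t ∈ Finset.Icc 1 T, τ t) := by
  rw [Finset.mul_sum, ← Finset.sum_add_distrib, Finset.mul_sum]
  refine Finset.sum_le_sum fun t ht => ?_
  rw [Finset.mem_Icc] at ht
  simpa using sum_sum_norm_sub_le fun i => hS.norm_xhat_sub_x_le hτ i ht.1 ht.2

lemma sum_norm_z_sub_x_le (hN : P.RegularNetwork w B) (hw : 0 < w) (hτ : ∀ t, 0 ≤ τ t)
    (hS : IsGenerated P α β γ τ T S) (h1 : 1 ≤ t) (h2 : t < T) :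
    ∑ i, ‖S.z i (t + 1) - S.x i t‖ ≤ 2 * deviation (fun i => S.xhat i t) + n * τ t := by
  have hW := (hN.isConsensusNetwork hw).mem_doublyStochastic t h1
  set v := fun i => S.xhat i t
  have through_mean (i : Fin n) : ‖S.z i (t + 1) - S.x i t‖ ≤
      ‖mix (P.W t) v i - mean (mix (P.W t) v)‖ + ‖v i - mean v‖ + τ t := by
    rw [hS.z_eq_mix i h1 h2, mean_mix hW, add_assoc, norm_sub_rev (v i)]
    refine (norm_sub_le_norm_sub_add_norm_sub _ (mean v) _).trans (add_le_add_right ?_ _)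
    exact (norm_sub_le_norm_sub_add_norm_sub _ (v i) _).trans
      (add_le_add_right (hS.norm_xhat_sub_x_le hτ i h1 h2.le) _)
  calc ∑ i, ‖S.z i (t + 1) - S.x i t‖
      ≤ ∑ i, (‖mix (P.W t) v i - mean (mix (P.W t) v)‖ + ‖v i - mean v‖ + τ t) :=
        Finset.sum_le_sum fun i _ => through_mean i
    _ = deviation (mix (P.W t) v) + deviation v + n * τ t := by
        simp [Finset.sum_add_distrib, deviation]
    _ ≤ 2 * deviation v + n * τ t := by linarith [deviation_mix_le_self hW v]

lemma totalMovement_le (hN : P.RegularNetwork w B) (hw : 0 < w) (hτ : ∀ t, 0 ≤ τ t)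
    (hS : IsGenerated P α β γ τ T S) :
    totalMovement S T ≤ totalStep S T +
      (2 * ∑ t ∈ Finset.Icc 1 T, deviation (fun i => S.xhat i t) +
        n * ∑ t ∈ Finset.Icc 1 T, τ t) := by
  calc totalMovement S T ≤ ∑ t ∈ Finset.Ico 1 T, (∑ i, ‖S.x i (t + 1) - S.z i (t + 1)‖ +
          (2 * deviation (fun i => S.xhat i t) + n * τ t)) := by
        refine Finset.sum_le_sum fun t ht => ?_
        rw [Finset.mem_Ico] at ht
        refine le_trans ?_
          (add_le_add_right (hS.sum_norm_z_sub_x_le hN hw hτ ht.1 ht.2) _)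
        rw [← Finset.sum_add_distrib]
        exact Finset.sum_le_sum fun i _ => norm_sub_le_norm_sub_add_norm_sub _ _ _
    _ = totalStep S T + (2 * ∑ t ∈ Finset.Ico 1 T, deviation (fun i => S.xhat i t) +
          n * ∑ t ∈ Finset.Ico 1 T, τ t) := by
        simp only [Finset.sum_add_distrib, Finset.mul_sum, totalStep]
    _ ≤ _ := by
        gcongr
        · exact fun _ _ _ => deviation_nonneg _
        · exact Finset.Ico_subset_Icc_self
        · exact fun t _ _ => hτ t
        · exact Finset.Ico_subset_Icc_self

end IsGenerated

end Trajectories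

section Summation

variable {n p : ℕ} {m : Fin n → ℕ} {P : Problem n p m} {F₁ F₂ R w : ℝ} {B T t : ℕ}
  {α β γ τ : ℕ → ℝ} {S : Trajectory n p m} {y : ℕ → Vec p}

/-- The regret of the agents with respect to their own losses, before the last round. The last
round is left out because it is not followed by a step of the algorithm. -/
noncomputable def localRegret (P : Problem n p m) (S : Trajectory n p m) (T : ℕ)
    (y : ℕ → Vec p) : ℝ :=
  ∑ t ∈ Finset.Ico 1 T, ∑ i, (P.f i t (S.x i t) - P.f i t (y t))

/-- The violation by the agents of their own constraints, before the last round. -/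
noncomputable def localViolation (P : Problem n p m) (S : Trajectory n p m) (T : ℕ) : ℝ :=
  ∑ t ∈ Finset.Ico 1 T, ∑ i, ‖nonnegPart (P.g i t (S.x i t))‖

lemma pathLength_nonneg (T : ℕ) (y : ℕ → Vec p) : 0 ≤ pathLength T y :=
  Finset.sum_nonneg fun _ _ => norm_nonneg _

lemma Problem.mem_X_of_mem_feasibleSequences (hy : y ∈ P.feasibleSequences T) (h1 : 1 ≤ t)
    (h2 : t ≤ T) : y t ∈ P.X :=
  (hy t (Finset.mem_Icc.2 ⟨h1, h2⟩)).1

lemma Problem.g_le_zero_of_mem_feasibleSequences (hy : y ∈ P.feasibleSequences T) (h1 : 1 ≤ t)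
    (h2 : t ≤ T) (i : Fin n) (l : Fin (m i)) : P.g i t (y t) l ≤ 0 :=
  (hy t (Finset.mem_Icc.2 ⟨h1, h2⟩)).2 ⟨i, l⟩

lemma AdmissibleStepSizes.inv_two_mul_alpha_monotoneOn (hA : AdmissibleStepSizes α β γ) :
    MonotoneOn (fun t => (2 * α t)⁻¹) (Set.Ici 1) :=
  monotoneOn_of_le_succ Set.ordConnected_Ici fun t _ ht _ =>
    inv_anti₀ (mul_pos two_pos (hA.alpha_pos _ (Nat.le_succ_of_le ht)))
      (mul_le_mul_of_nonneg_left (hA.alpha_succ_le t ht) two_pos.le)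

namespace IsGenerated

lemma neg_le_sum_dual (hA : AdmissibleStepSizes α β γ) (hT : 1 ≤ T)
    (hS : IsGenerated P α β γ τ T S) (i : Fin n) (μ : Vec (m i)) :
    -(‖μ‖ ^ 2 / (2 * γ 1)) ≤ ∑ t ∈ Finset.Ico 1 T,
      (‖S.q i (t + 1) - μ‖ ^ 2 - (1 - β (t + 1) * γ (t + 1)) * ‖S.q i t - μ‖ ^ 2) /
        (2 * γ (t + 1)) := by
  set u : ℕ → ℝ := fun t => ‖S.q i t - μ‖ ^ 2 / (2 * γ t) with hu
  have first : u 1 = ‖μ‖ ^ 2 / (2 * γ 1) := by simp [hu, hS.init_q i]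
  have last : 0 ≤ u T := div_nonneg (by positivity) (by linarith [hA.gamma_pos T hT])
  have increment : ∀ t ∈ Finset.Ico 1 T, u (t + 1) - u t ≤
      (‖S.q i (t + 1) - μ‖ ^ 2 - (1 - β (t + 1) * γ (t + 1)) * ‖S.q i t - μ‖ ^ 2) /
        (2 * γ (t + 1)) := fun t ht => by
    have weights := mul_le_mul_of_nonneg_right
      (hA.one_sub_div_gamma_succ_le t (Finset.mem_Ico.1 ht).1)
      (by positivity : 0 ≤ ‖S.q i t - μ‖ ^ 2 / 2)
    rw [div_mul_div_comm, div_mul_div_comm, one_mul, mul_comm _ 2, mul_comm _ 2] at weights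
    rw [sub_div]
    exact sub_le_sub_left weights _
  have telescope : ∑ t ∈ Finset.Ico 1 T, (u (t + 1) - u t) = u T - u 1 :=
    Finset.sum_Ico_sub u hT
  linarith [Finset.sum_le_sum increment]

lemma sum_norm_z_sub_sq_le (hD : P.RegularData F₁ F₂ R) (hN : P.RegularNetwork w B) (hw : 0 < w)
    (hR : 0 ≤ R) (hτ : ∀ t, 0 ≤ τ t) (hS : IsGenerated P α β γ τ T S) (h1 : 1 ≤ t) (h2 : t < T)
    {a : Vec p} (ha : a ∈ P.X) :
    ∑ i, ‖S.z i (t + 1) - a‖ ^ 2 ≤ ∑ i, ‖S.x i t - a‖ ^ 2 + 4 * n * R * τ t := by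
  calc ∑ i, ‖S.z i (t + 1) - a‖ ^ 2
      = ∑ i, ‖mix (P.W t) (fun j => S.xhat j t) i - a‖ ^ 2 := by
        simp_rw [hS.z_eq_mix _ h1 h2]
    _ ≤ ∑ i, ‖S.xhat i t - a‖ ^ 2 :=
        sum_norm_mix_sub_sq_le ((hN.isConsensusNetwork hw).mem_doublyStochastic t h1) _ _
    _ ≤ ∑ i, (‖S.x i t - a‖ ^ 2 + 4 * R * τ t) := by
        refine Finset.sum_le_sum fun i _ => (hD.norm_sub_sq_le_add (hS.xhat_mem i h1 h2.le)
          (hS.x_mem i h1 h2.le) ha).trans ?_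
        gcongr
        exact hS.norm_xhat_sub_x_le hτ i h1 h2.le
    _ = ∑ i, ‖S.x i t - a‖ ^ 2 + 4 * n * R * τ t := by
        simp only [Finset.sum_add_distrib, Finset.sum_const, Finset.card_univ, Fintype.card_fin,
          nsmul_eq_mul]
        ring

lemma sum_norm_x_sub_sq_le (hD : P.RegularData F₁ F₂ R) (hS : IsGenerated P α β γ τ T S)
    (h1 : 1 ≤ t) (h2 : t ≤ T) {a b : Vec p} (ha : a ∈ P.X) (hb : b ∈ P.X) :
    ∑ i, ‖S.x i t - b‖ ^ 2 ≤ ∑ i, ‖S.x i t - a‖ ^ 2 + 4 * n * R * ‖b - a‖ := by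
  calc ∑ i, ‖S.x i t - b‖ ^ 2 ≤ ∑ i, (‖S.x i t - a‖ ^ 2 + 4 * R * ‖b - a‖) := by
        refine Finset.sum_le_sum fun i _ => ?_
        rw [norm_sub_rev _ b, norm_sub_rev _ a]
        exact hD.norm_sub_sq_le_add hb ha (hS.x_mem i h1 h2)
    _ = ∑ i, ‖S.x i t - a‖ ^ 2 + 4 * n * R * ‖b - a‖ := by
        simp only [Finset.sum_add_distrib, Finset.sum_const, Finset.card_univ, Fintype.card_fin,
          nsmul_eq_mul]
        ring

lemma sum_primal_round_le (hD : P.RegularData F₁ F₂ R) (hN : P.RegularNetwork w B) (hw : 0 < w)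
    (hR : 0 ≤ R) (hτ : ∀ t, 0 ≤ τ t) (hS : IsGenerated P α β γ τ T S)
    (hy : y ∈ P.feasibleSequences T) (h1 : 1 ≤ t) (h2 : t < T) :
    ∑ i, (‖S.z i (t + 1) - y t‖ ^ 2 - ‖S.x i (t + 1) - y t‖ ^ 2) ≤
      ∑ i, ‖S.x i t - y t‖ ^ 2 - ∑ i, ‖S.x i (t + 1) - y (t + 1)‖ ^ 2 +
        4 * n * R * (τ t + ‖y (t + 1) - y t‖) := by
  have hyt := P.mem_X_of_mem_feasibleSequences hy h1 h2.le
  have hyt' := P.mem_X_of_mem_feasibleSequences hy (Nat.le_succ_of_le h1) h2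
  have triggering := hS.sum_norm_z_sub_sq_le hD hN hw hR hτ h1 h2 hyt
  have drift := hS.sum_norm_x_sub_sq_le hD (Nat.le_succ_of_le h1) h2 hyt hyt'
  rw [Finset.sum_sub_distrib]
  linarith

lemma sum_norm_x_sub_sq_le_four_mul (hD : P.RegularData F₁ F₂ R)
    (hS : IsGenerated P α β γ τ T S) (h1 : 1 ≤ t) (h2 : t ≤ T) {a : Vec p} (ha : a ∈ P.X) :
    ∑ i, ‖S.x i t - a‖ ^ 2 ≤ 4 * n * R ^ 2 :=
  calc ∑ i, ‖S.x i t - a‖ ^ 2 ≤ ∑ _i : Fin n, (2 * R) ^ 2 := Finset.sum_le_sum fun i _ =>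
        pow_le_pow_left₀ (norm_nonneg _) (hD.norm_sub_le_two_mul (hS.x_mem i h1 h2) ha) 2
    _ = 4 * n * R ^ 2 := by
        rw [Finset.sum_const, Finset.card_univ, Fintype.card_fin, nsmul_eq_mul]
        ring

lemma sum_primal_le (hD : P.RegularData F₁ F₂ R) (hN : P.RegularNetwork w B) (hw : 0 < w)
    (hR : 0 ≤ R) (hA : AdmissibleStepSizes α β γ) (hτ : ∀ t, 0 ≤ τ t) (hT : 1 ≤ T)
    (hS : IsGenerated P α β γ τ T S) (hy : y ∈ P.feasibleSequences T) :
    ∑ t ∈ Finset.Ico 1 T, ∑ i, (‖S.z i (t + 1) - y t‖ ^ 2 - ‖S.x i (t + 1) - y t‖ ^ 2) /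
        (2 * α (t + 1)) ≤
      2 * n * R * (R + ∑ t ∈ Finset.Icc 1 T, τ t + pathLength T y) / α T := by
  set a : ℕ → ℝ := fun t => (2 * α t)⁻¹ with ha
  set d : ℕ → ℝ := fun t => ∑ i, ‖S.x i t - y t‖ ^ 2
  have ha_mono := hA.inv_two_mul_alpha_monotoneOn
  have ha_pos (t : ℕ) (ht : 1 ≤ t) : 0 < a t := inv_pos.2 (mul_pos two_pos (hA.alpha_pos t ht))
  calc ∑ t ∈ Finset.Ico 1 T, ∑ i, (‖S.z i (t + 1) - y t‖ ^ 2 - ‖S.x i (t + 1) - y t‖ ^ 2) /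
        (2 * α (t + 1))
      ≤ ∑ t ∈ Finset.Ico 1 T, (a (t + 1) * (d t - d (t + 1)) +
          a T * (4 * n * R * (τ t + ‖y (t + 1) - y t‖))) := by
        refine Finset.sum_le_sum fun t ht => ?_
        obtain ⟨h1, h2⟩ := Finset.mem_Ico.1 ht
        have round := mul_le_mul_of_nonneg_left (hS.sum_primal_round_le hD hN hw hR hτ hy h1 h2)
          (ha_pos (t + 1) (Nat.le_succ_of_le h1)).le
        rw [← Finset.sum_div, div_eq_inv_mul]
        refine round.trans ?_
        rw [mul_add]
        have := hτ t
        gcongr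
        exact ha_mono (Nat.le_succ_of_le h1) hT h2
    _ = ∑ t ∈ Finset.Ico 1 T, a (t + 1) * (d t - d (t + 1)) +
          a T * (4 * n * R * (∑ t ∈ Finset.Ico 1 T, τ t + pathLength T y)) := by
        rw [Finset.sum_add_distrib, ← Finset.mul_sum, ← Finset.mul_sum, Finset.sum_add_distrib,
          pathLength]
    _ ≤ a T * (4 * n * R ^ 2) +
          a T * (4 * n * R * (∑ t ∈ Finset.Icc 1 T, τ t + pathLength T y)) := by
        have := (ha_pos T hT).le
        gcongr
        · exact sum_mul_sub_succ_le hT (fun t => by positivity)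
            (fun t h1 h2 => hS.sum_norm_x_sub_sq_le_four_mul hD h1 h2
              (P.mem_X_of_mem_feasibleSequences hy h1 h2)) (ha_pos 1 le_rfl).le
            fun t ht => ha_mono ht (Nat.le_succ_of_le ht) (Nat.le_succ t)
        · exact fun t _ _ => hτ t
        · exact Finset.Ico_subset_Icc_self
    _ = 2 * n * R * (R + ∑ t ∈ Finset.Icc 1 T, τ t + pathLength T y) / α T := by
        simp only [ha, mul_inv]
        ring

lemma norm_linearizedViolation_sub_le (hD : P.RegularData F₁ F₂ R) (hP : P.PosPartSubgradients)
    (hF₁ : 0 ≤ F₁) (hF₂ : 0 ≤ F₂) (hA : AdmissibleStepSizes α β γ)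
    (hS : IsGenerated P α β γ τ T S) (i : Fin n) (h1 : 1 ≤ t) (h2 : t < T) :
    ‖linearizedViolation (P.g i t) (P.subgPos i t (S.x i t)) (S.x i t) (S.x i (t + 1)) -
      β (t + 1) • S.q i t‖ ≤ 2 * F₁ + 2 * R * F₂ := by
  have hx := hS.x_mem i h1 h2.le
  have hx' := hS.x_mem i (Nat.le_succ_of_le h1) h2
  have linearized := norm_linearizedViolation_le (g := P.g i t) (hD.norm_subgPos_le hP h1 hx)
    (S.x i t) (S.x i (t + 1))
  have movement : F₂ * ‖S.x i (t + 1) - S.x i t‖ ≤ F₂ * (2 * R) :=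
    mul_le_mul_of_nonneg_left (hD.norm_sub_le_two_mul hx' hx) hF₂
  have dual : ‖β (t + 1) • S.q i t‖ ≤ F₁ := by
    rw [norm_smul, Real.norm_of_nonneg (hA.beta_nonneg _ (Nat.le_succ_of_le h1))]
    exact (mul_le_mul_of_nonneg_right (hA.beta_succ_le t h1) (norm_nonneg _)).trans
      (hS.beta_mul_norm_q_le hD hP hF₁ hA i h1 h2.le)
  linarith [norm_sub_le (linearizedViolation (P.g i t) (P.subgPos i t (S.x i t)) (S.x i t)
    (S.x i (t + 1))) (β (t + 1) • S.q i t), hD.g_bound i t h1 _ hx]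

lemma localRegret_round_le (hD : P.RegularData F₁ F₂ R) (hP : P.PosPartSubgradients)
    (hF₁ : 0 ≤ F₁) (hF₂ : 0 ≤ F₂) (hA : AdmissibleStepSizes α β γ)
    (hS : IsGenerated P α β γ τ T S) (hy : y ∈ P.feasibleSequences T) (i : Fin n) (h1 : 1 ≤ t)
    (h2 : t < T) {μ : Vec (m i)} (hμ : ∀ l, 0 ≤ μ l) {ρ : ℝ} (hρ : ‖μ‖ ≤ ρ) :
    P.f i t (S.x i t) - P.f i t (y t) + inner ℝ μ (nonnegPart (P.g i t (S.x i t))) +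
        ‖S.x i (t + 1) - S.z i (t + 1)‖ ^ 2 / (2 * α (t + 1)) +
        (‖S.q i (t + 1) - μ‖ ^ 2 - (1 - β (t + 1) * γ (t + 1)) * ‖S.q i t - μ‖ ^ 2) /
          (2 * γ (t + 1)) ≤
      γ (t + 1) / 2 * (2 * F₁ + 2 * R * F₂) ^ 2 + β (t + 1) / 2 * ρ ^ 2 +
        F₂ * (1 + ρ) * ‖S.x i (t + 1) - S.x i t‖ +
        (‖S.z i (t + 1) - y t‖ ^ 2 - ‖S.x i (t + 1) - y t‖ ^ 2) / (2 * α (t + 1)) := by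
  have ht : 1 ≤ t + 1 := Nat.le_succ_of_le h1
  have hx := hS.x_mem i h1 h2.le
  rw [hS.step_q i t h1 h2]
  refine (primal_dual_step_le hD.convex (P.mem_X_of_mem_feasibleSequences hy h1 h2.le)
    (P.g_le_zero_of_mem_feasibleSequences hy h1 h2.le i) (hD.subf_spec i t h1 _ hx)
    (hD.subf_bound i t h1 _ hx) (hP.isSubgradient i t h1 _ hx) (hD.norm_subgPos_le hP h1 hx)
    (hS.q_nonneg i h1 h2.le) hμ (hA.alpha_pos _ ht) (hA.beta_nonneg _ ht) (hA.gamma_pos _ ht)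
    (hS.norm_linearizedViolation_sub_le hD hP hF₁ hF₂ hA i h1 h2)
    (hS.step_ω i t h1 h2 ▸ hS.step_x i t h1 h2)).trans ?_
  have := hA.beta_nonneg _ ht
  gcongr

lemma neg_le_sum_sum_dual (hA : AdmissibleStepSizes α β γ) (hT : 1 ≤ T)
    (hS : IsGenerated P α β γ τ T S) {μ : ∀ i, Vec (m i)} {ρ : ℝ} (hρ : ∀ i, ‖μ i‖ ≤ ρ) :
    -(n * (ρ ^ 2 / (2 * γ 1))) ≤ ∑ t ∈ Finset.Ico 1 T, ∑ i,
      (‖S.q i (t + 1) - μ i‖ ^ 2 - (1 - β (t + 1) * γ (t + 1)) * ‖S.q i t - μ i‖ ^ 2) /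
        (2 * γ (t + 1)) := by
  have agent (i : Fin n) : -(ρ ^ 2 / (2 * γ 1)) ≤ -(‖μ i‖ ^ 2 / (2 * γ 1)) := by
    have := hA.gamma_pos 1 le_rfl
    have := hρ i
    gcongr
  rw [Finset.sum_comm]
  calc -(n * (ρ ^ 2 / (2 * γ 1))) = ∑ _i : Fin n, -(ρ ^ 2 / (2 * γ 1)) := by simp
    _ ≤ _ := Finset.sum_le_sum fun i _ => (agent i).trans (hS.neg_le_sum_dual hA hT i (μ i))

lemma localRegret_add_sum_inner_le (hD : P.RegularData F₁ F₂ R) (hP : P.PosPartSubgradients)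
    (hN : P.RegularNetwork w B) (hw : 0 < w) (hF₁ : 0 ≤ F₁) (hF₂ : 0 ≤ F₂) (hR : 0 ≤ R)
    (hA : AdmissibleStepSizes α β γ) (hτ : ∀ t, 0 ≤ τ t) (hT : 1 ≤ T)
    (hS : IsGenerated P α β γ τ T S) (hy : y ∈ P.feasibleSequences T) {μ : ∀ i, Vec (m i)}
    (hμ : ∀ i l, 0 ≤ μ i l) {ρ : ℝ} (hρ : ∀ i, ‖μ i‖ ≤ ρ) :
    localRegret P S T y +
        ∑ t ∈ Finset.Ico 1 T, ∑ i, inner ℝ (μ i) (nonnegPart (P.g i t (S.x i t))) +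
        stepEnergy α S T / 2 ≤
      n * ((2 * F₁ + 2 * R * F₂) ^ 2 / 2 * ∑ t ∈ Finset.Ico 1 T, γ (t + 1) +
        ρ ^ 2 / 2 * (∑ t ∈ Finset.Ico 1 T, β (t + 1) + 1 / γ 1)) +
      F₂ * (1 + ρ) * totalMovement S T +
      2 * n * R * (R + ∑ t ∈ Finset.Icc 1 T, τ t + pathLength T y) / α T := by
  have rounds := Finset.sum_le_sum fun t ht => Finset.sum_le_sum fun i (_ : i ∈ Finset.univ) =>
    hS.localRegret_round_le hD hP hF₁ hF₂ hA hy i (Finset.mem_Ico.1 ht).1 (Finset.mem_Ico.1 ht).2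
      (hμ i) (hρ i)
  simp only [Finset.sum_add_distrib, ← Finset.mul_sum, Finset.sum_const, Finset.card_univ,
    Fintype.card_fin, nsmul_eq_mul, ← Finset.sum_mul, ← Finset.sum_div] at rounds
  have energy : ∑ t ∈ Finset.Ico 1 T, (∑ i, ‖S.x i (t + 1) - S.z i (t + 1)‖ ^ 2) /
      (2 * α (t + 1)) = stepEnergy α S T / 2 := by
    simp_rw [stepEnergy, Finset.sum_div, div_div, mul_comm (α _)]
  have dual := hS.neg_le_sum_sum_dual hA hT hρ
  have primal := hS.sum_primal_le hD hN hw hR hA hτ hT hy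
  simp only [← Finset.sum_div] at dual primal
  rw [← div_div, div_eq_mul_one_div _ (γ 1)] at dual
  rw [energy] at rounds
  rw [localRegret, totalMovement]
  linarith

lemma localRegret_add_mul_localViolation_le (hD : P.RegularData F₁ F₂ R)
    (hP : P.PosPartSubgradients) (hN : P.RegularNetwork w B) (hw : 0 < w) (hF₁ : 0 ≤ F₁)
    (hF₂ : 0 ≤ F₂) (hR : 0 ≤ R) (hA : AdmissibleStepSizes α β γ) (hτ : ∀ t, 0 ≤ τ t) (hT : 1 ≤ T)
    (hS : IsGenerated P α β γ τ T S) (hy : y ∈ P.feasibleSequences T) {r : ℝ} (hr : 0 ≤ r) :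
    localRegret P S T y + r * localViolation P S T + stepEnergy α S T / 2 ≤
      n * ((2 * F₁ + 2 * R * F₂) ^ 2 / 2 * ∑ t ∈ Finset.Ico 1 T, γ (t + 1) +
        ((∑ i, m i : ℕ) * r) ^ 2 / 2 * (∑ t ∈ Finset.Ico 1 T, β (t + 1) + 1 / γ 1)) +
      F₂ * (1 + (∑ i, m i : ℕ) * r) * totalMovement S T +
      2 * n * R * (R + ∑ t ∈ Finset.Icc 1 T, τ t + pathLength T y) / α T := by
  have violation : r * localViolation P S T ≤ ∑ t ∈ Finset.Ico 1 T, ∑ i,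
      inner ℝ (constVec (Fin (m i)) r) (nonnegPart (P.g i t (S.x i t))) := by
    simp_rw [localViolation, Finset.mul_sum]
    exact Finset.sum_le_sum fun t _ => Finset.sum_le_sum fun i _ =>
      mul_norm_le_inner_constVec hr fun l => nonnegPart_apply_nonneg _ l
  have dual_norm (i : Fin n) : ‖constVec (Fin (m i)) r‖ ≤ (∑ i, m i : ℕ) * r := by
    refine (norm_constVec_le hr).trans (mul_le_mul_of_nonneg_right ?_ hr)
    rw [Fintype.card_fin]
    exact_mod_cast Finset.single_le_sum (fun j _ => Nat.zero_le (m j)) (Finset.mem_univ i)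
  linarith [hS.localRegret_add_sum_inner_le hD hP hN hw hF₁ hF₂ hR hA hτ hT hy
    (μ := fun i => constVec (Fin (m i)) r) (fun _ _ => hr) dual_norm]

end IsGenerated

end Summation

section Network

variable {n p : ℕ} {m : Fin n → ℕ} {P : Problem n p m} {F₁ F₂ R : ℝ} {T t : ℕ}
  {α β γ τ : ℕ → ℝ} {S : Trajectory n p m} {y : ℕ → Vec p}

lemma one_div_mul_add_le (hn : 0 < n) {a b : ℝ} (hb : 0 ≤ b) :
    1 / (n : ℝ) * (n * a + b) ≤ a + b := by
  have hn' : (1 : ℝ) ≤ n := Nat.one_le_cast.2 hn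
  rw [mul_add, one_div, inv_mul_cancel_left₀ (by positivity)]
  exact add_le_add_right (mul_le_of_le_one_left hb (inv_le_one_of_one_le₀ hn')) a

lemma norm_nonnegPart_globalConstraint_le (P : Problem n p m) (t : ℕ) (x : Vec p) :
    ‖nonnegPart (P.globalConstraint t x)‖ ≤ ∑ j, ‖nonnegPart (P.g j t x)‖ := by
  have norm_sq : ‖nonnegPart (P.globalConstraint t x)‖ ^ 2 = ∑ j, ‖nonnegPart (P.g j t x)‖ ^ 2 := by
    simp_rw [EuclideanSpace.norm_sq_eq, Fintype.sum_sigma]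
    rfl
  refine (sq_le_sq₀ (norm_nonneg _) (Finset.sum_nonneg fun _ _ => norm_nonneg _)).1 ?_
  rw [norm_sq]
  exact Finset.sum_sq_le_sq_sum_of_nonneg fun _ _ => norm_nonneg _

lemma natCast_mul_netReg (hn : 0 < n) :
    n * netReg P T S.x y =
      ∑ t ∈ Finset.Icc 1 T, ∑ i, (P.globalLoss t (S.x i t) - P.globalLoss t (y t)) := by
  have hn' : (n : ℝ) ≠ 0 := Nat.cast_ne_zero.2 hn.ne'
  simp only [netReg, Finset.sum_sub_distrib, Finset.sum_const, Finset.card_univ, Fintype.card_fin,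
    nsmul_eq_mul, ← Finset.mul_sum]
  rw [Finset.sum_comm, mul_sub, ← mul_assoc, mul_one_div_cancel hn', one_mul]

namespace IsGenerated

lemma sum_norm_nonnegPart_globalConstraint_le (hD : P.RegularData F₁ F₂ R)
    (hP : P.PosPartSubgradients) (hS : IsGenerated P α β γ τ T S) (h1 : 1 ≤ t) (h2 : t ≤ T) :
    ∑ i, ‖nonnegPart (P.globalConstraint t (S.x i t))‖ ≤
      n * ∑ j, ‖nonnegPart (P.g j t (S.x j t))‖ + F₂ * ∑ i, ∑ j, ‖S.x i t - S.x j t‖ := by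
  calc ∑ i, ‖nonnegPart (P.globalConstraint t (S.x i t))‖
      ≤ ∑ i, ∑ j, (‖nonnegPart (P.g j t (S.x j t))‖ + F₂ * ‖S.x i t - S.x j t‖) := by
        refine Finset.sum_le_sum fun i _ =>
          (norm_nonnegPart_globalConstraint_le P t _).trans (Finset.sum_le_sum fun j _ => ?_)
        have hx := hS.x_mem i h1 h2
        exact norm_nonnegPart_le_add (hP.isSubgradient j t h1 _ hx) (hD.norm_subgPos_le hP h1 hx)
          (hS.x_mem j h1 h2)
    _ = n * ∑ j, ‖nonnegPart (P.g j t (S.x j t))‖ + F₂ * ∑ i, ∑ j, ‖S.x i t - S.x j t‖ := by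
        simp only [Finset.sum_add_distrib, Finset.sum_const, Finset.card_univ, Fintype.card_fin,
          nsmul_eq_mul, ← Finset.mul_sum]

lemma sum_violation_le (hD : P.RegularData F₁ F₂ R) (hT : 1 ≤ T)
    (hS : IsGenerated P α β γ τ T S) :
    ∑ t ∈ Finset.Icc 1 T, ∑ j, ‖nonnegPart (P.g j t (S.x j t))‖ ≤
      localViolation P S T + n * F₁ := by
  rw [← Finset.sum_Ico_add_eq_sum_Icc hT]
  refine add_le_add_right ?_ _
  calc ∑ j, ‖nonnegPart (P.g j T (S.x j T))‖ ≤ ∑ _j : Fin n, F₁ := Finset.sum_le_sum fun j _ =>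
        (norm_nonnegPart_le _).trans (hD.g_bound j T hT _ (hS.x_mem j hT le_rfl))
    _ = n * F₁ := by simp

lemma netCCV_le (hD : P.RegularData F₁ F₂ R) (hP : P.PosPartSubgradients) (hF₂ : 0 ≤ F₂)
    (hn : 0 < n) (hT : 1 ≤ T) (hS : IsGenerated P α β γ τ T S) :
    netCCV P T S.x ≤ localViolation P S T + n * F₁ + F₂ * disagreement S T := by
  have rounds := Finset.sum_le_sum fun t (ht : t ∈ Finset.Icc 1 T) =>
    hS.sum_norm_nonnegPart_globalConstraint_le hD hP (Finset.mem_Icc.1 ht).1 (Finset.mem_Icc.1 ht).2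
  rw [Finset.sum_add_distrib, ← Finset.mul_sum, ← Finset.mul_sum, Finset.sum_comm] at rounds
  calc netCCV P T S.x
      ≤ 1 / (n : ℝ) * (n * ∑ t ∈ Finset.Icc 1 T, ∑ j, ‖nonnegPart (P.g j t (S.x j t))‖ +
          F₂ * disagreement S T) := mul_le_mul_of_nonneg_left rounds (by positivity)
    _ ≤ ∑ t ∈ Finset.Icc 1 T, ∑ j, ‖nonnegPart (P.g j t (S.x j t))‖ + F₂ * disagreement S T :=
        one_div_mul_add_le hn (mul_nonneg hF₂ (disagreement_nonneg S T))
    _ ≤ localViolation P S T + n * F₁ + F₂ * disagreement S T :=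
        add_le_add_left (hS.sum_violation_le hD hT) _

lemma sum_globalLoss_sub_le (hD : P.RegularData F₁ F₂ R) (hS : IsGenerated P α β γ τ T S)
    (h1 : 1 ≤ t) (h2 : t ≤ T) (a : Vec p) :
    n * ∑ i, (P.globalLoss t (S.x i t) - P.globalLoss t a) ≤
      n * ∑ j, (P.f j t (S.x j t) - P.f j t a) + F₂ * ∑ i, ∑ j, ‖S.x i t - S.x j t‖ := by
  calc n * ∑ i, (P.globalLoss t (S.x i t) - P.globalLoss t a)
      = ∑ i, ∑ j, (P.f j t (S.x i t) - P.f j t a) := by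
        rw [Finset.mul_sum]
        refine Finset.sum_congr rfl fun i _ => ?_
        have hn : (n : ℝ) ≠ 0 := Nat.cast_ne_zero.2 (Fin.pos i).ne'
        rw [Problem.globalLoss, Problem.globalLoss, ← mul_sub, ← mul_assoc,
          mul_one_div_cancel hn, one_mul, Finset.sum_sub_distrib]
    _ ≤ ∑ i, ∑ j, ((P.f j t (S.x j t) - P.f j t a) + F₂ * ‖S.x i t - S.x j t‖) :=
        Finset.sum_le_sum fun i _ => Finset.sum_le_sum fun j _ => by
          linarith [hD.f_le_add (i := j) h1 (hS.x_mem i h1 h2) (hS.x_mem j h1 h2)]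
    _ = n * ∑ j, (P.f j t (S.x j t) - P.f j t a) + F₂ * ∑ i, ∑ j, ‖S.x i t - S.x j t‖ := by
        simp only [Finset.sum_add_distrib, Finset.sum_const, Finset.card_univ, Fintype.card_fin,
          nsmul_eq_mul, ← Finset.mul_sum]

lemma sum_regret_le (hD : P.RegularData F₁ F₂ R) (hT : 1 ≤ T)
    (hS : IsGenerated P α β γ τ T S) (hy : y ∈ P.feasibleSequences T) :
    ∑ t ∈ Finset.Icc 1 T, ∑ j, (P.f j t (S.x j t) - P.f j t (y t)) ≤
      localRegret P S T y + n * F₁ := by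
  rw [← Finset.sum_Ico_add_eq_sum_Icc hT]
  refine add_le_add_right ?_ _
  calc ∑ j, (P.f j T (S.x j T) - P.f j T (y T)) ≤ ∑ _j : Fin n, F₁ := Finset.sum_le_sum fun j _ =>
        le_of_abs_le (hD.f_bound j T hT _ (hS.x_mem j hT le_rfl) _
          (P.mem_X_of_mem_feasibleSequences hy hT le_rfl))
    _ = n * F₁ := by simp

lemma natCast_mul_netReg_le (hD : P.RegularData F₁ F₂ R) (hF₂ : 0 ≤ F₂) (hn : 0 < n) (hT : 1 ≤ T)
    (hS : IsGenerated P α β γ τ T S) (hy : y ∈ P.feasibleSequences T) :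
    n * netReg P T S.x y ≤ localRegret P S T y + n * F₁ + F₂ * disagreement S T := by
  have rounds := Finset.sum_le_sum fun t (ht : t ∈ Finset.Icc 1 T) =>
    hS.sum_globalLoss_sub_le hD (Finset.mem_Icc.1 ht).1 (Finset.mem_Icc.1 ht).2 (y t)
  rw [Finset.sum_add_distrib, ← Finset.mul_sum, ← Finset.mul_sum, ← Finset.mul_sum,
    ← natCast_mul_netReg hn] at rounds
  have hn' : (0 : ℝ) < n := Nat.cast_pos.2 hn
  calc n * netReg P T S.x y
      ≤ 1 / (n : ℝ) * (n * ∑ t ∈ Finset.Icc 1 T, ∑ j, (P.f j t (S.x j t) - P.f j t (y t)) +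
          F₂ * disagreement S T) := by
        rw [one_div, ← div_eq_inv_mul, le_div_iff₀' hn']
        exact rounds
    _ ≤ ∑ t ∈ Finset.Icc 1 T, ∑ j, (P.f j t (S.x j t) - P.f j t (y t)) + F₂ * disagreement S T :=
        one_div_mul_add_le hn (mul_nonneg hF₂ (disagreement_nonneg S T))
    _ ≤ localRegret P S T y + n * F₁ + F₂ * disagreement S T :=
        add_le_add_left (hS.sum_regret_le hD hT hy) _

lemma neg_le_localRegret (hD : P.RegularData F₁ F₂ R) (hF₁ : 0 ≤ F₁)
    (hS : IsGenerated P α β γ τ T S) (hy : y ∈ P.feasibleSequences T) :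
    -(n * F₁ * T) ≤ localRegret P S T y := by
  calc -(n * F₁ * T) ≤ -(n * F₁ * (T - 1 : ℕ)) := by
        gcongr
        exact Nat.sub_le _ _
    _ = ∑ _t ∈ Finset.Ico 1 T, ∑ _i : Fin n, -F₁ := by simp; ring
    _ ≤ localRegret P S T y := by
        refine Finset.sum_le_sum fun t ht => Finset.sum_le_sum fun i _ => ?_
        obtain ⟨h1, h2⟩ := Finset.mem_Ico.1 ht
        exact neg_le_of_abs_le (hD.f_bound i t h1 _ (hS.x_mem i h1 h2.le) _
          (P.mem_X_of_mem_feasibleSequences hy h1 h2.le))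

end IsGenerated

end Network

section StepSizes

variable {c κ : ℝ} {t : ℕ}

lemma geomThreshold_pos (hc : 1 < c) (t : ℕ) : 0 < geomThreshold c t :=
  one_div_pos.2 (pow_pos (zero_lt_one.trans hc) t)

lemma geomThreshold_antitone (hc : 1 < c) : Antitone (geomThreshold c) := fun s _ hst =>
  one_div_le_one_div_of_le (pow_pos (zero_lt_one.trans hc) s) (pow_le_pow_right₀ hc.le hst)

lemma sum_geomThreshold_le (hc : 1 < c) (T : ℕ) :
    ∑ t ∈ Finset.Icc 1 T, geomThreshold c t ≤ 1 / (c - 1) := by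
  have hc₀ : c ≠ 0 := (zero_lt_one.trans hc).ne'
  have hc₁ : 0 < c - 1 := sub_pos.2 hc
  have closed_form : ∑ t ∈ Finset.Icc 1 T, geomThreshold c t = (1 - 1 / c ^ T) / (c - 1) := by
    induction T with
    | zero => simp
    | succ T ih =>
      rw [Finset.sum_Icc_succ_top (Nat.le_add_left 1 T), ih, geomThreshold, pow_succ]
      field_simp
      ring
  rw [closed_form]
  exact div_le_div_of_nonneg_right (sub_le_self 1 (geomThreshold_pos hc T).le) hc₁.le

lemma one_div_le_sum_geomThreshold (hc : 1 < c) (ht : 1 ≤ t) :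
    1 / c ≤ ∑ s ∈ Finset.Icc 1 t, geomThreshold c s := by
  have := Finset.single_le_sum (f := geomThreshold c)
    (fun s _ => (geomThreshold_pos hc s).le) (Finset.mem_Icc.2 ⟨le_rfl, ht⟩)
  rwa [geomThreshold, pow_one] at this

lemma mul_geomThreshold_succ_le_sum (hc : 1 < c) (t : ℕ) :
    t * geomThreshold c (t + 1) ≤ ∑ s ∈ Finset.Icc 1 t, geomThreshold c s := by
  simpa using Finset.card_nsmul_le_sum (Finset.Icc 1 t) (geomThreshold c) _ fun s hs =>
    geomThreshold_antitone hc (Nat.le_succ_of_le (Finset.mem_Icc.1 hs).2)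

lemma stepAlpha_pos (hc : 1 < c) (ht : 1 ≤ t) : 0 < stepAlpha (geomThreshold c) t :=
  Real.sqrt_pos.2 (div_pos ((one_div_pos.2 (zero_lt_one.trans hc)).trans_le
    (one_div_le_sum_geomThreshold hc ht)) (Nat.cast_pos.2 ht))

-- `Ψ_t / t` is the average of the decreasing sequence `τ_1, …, τ_t`.
lemma stepAlpha_succ_le (hc : 1 < c) (ht : 1 ≤ t) :
    stepAlpha (geomThreshold c) (t + 1) ≤ stepAlpha (geomThreshold c) t := by
  have ht' : (0 : ℝ) < t := Nat.cast_pos.2 ht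
  refine Real.sqrt_le_sqrt ?_
  rw [Finset.sum_Icc_succ_top (Nat.le_add_left 1 t), div_le_div_iff₀ (by positivity) ht',
    Nat.cast_succ]
  linarith [mul_geomThreshold_succ_le_sum hc t]

lemma stepAlpha_le (hc : 1 < c) (t : ℕ) :
    stepAlpha (geomThreshold c) t ≤ √(1 / (c - 1)) * (1 / (t : ℝ) ^ (1 / 2 : ℝ)) := by
  rw [stepAlpha, Real.sqrt_div' _ t.cast_nonneg, ← Real.sqrt_eq_rpow, mul_one_div]
  gcongr
  exact sum_geomThreshold_le hc t

lemma one_div_stepAlpha_le (hc : 1 < c) (ht : 1 ≤ t) :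
    1 / stepAlpha (geomThreshold c) t ≤ √c * (t : ℝ) ^ (1 / 2 : ℝ) := by
  have hc₀ : 0 < c := zero_lt_one.trans hc
  have ht' : (0 : ℝ) < t := Nat.cast_pos.2 ht
  have lower : 1 / (c * t) ≤ (∑ s ∈ Finset.Icc 1 t, geomThreshold c s) / t := by
    rw [← div_div]
    exact div_le_div_of_nonneg_right (one_div_le_sum_geomThreshold hc ht) ht'.le
  rw [← Real.sqrt_eq_rpow, ← Real.sqrt_mul hc₀.le,
    one_div_le (stepAlpha_pos hc ht) (by positivity), ← Real.sqrt_one,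
    ← Real.sqrt_div' _ (by positivity)]
  exact Real.sqrt_le_sqrt lower

lemma sum_stepAlpha_le (hc : 1 < c) (T : ℕ) :
    ∑ t ∈ Finset.Ico 1 T, stepAlpha (geomThreshold c) (t + 1) ≤
      2 * √(1 / (c - 1)) * (T : ℝ) ^ (1 / 2 : ℝ) := by
  calc ∑ t ∈ Finset.Ico 1 T, stepAlpha (geomThreshold c) (t + 1)
      ≤ ∑ t ∈ Finset.Icc 1 T, stepAlpha (geomThreshold c) t :=
        sum_Ico_succ_le_sum_Icc (u := stepAlpha (geomThreshold c)) (fun _ => Real.sqrt_nonneg _) T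
    _ ≤ √(1 / (c - 1)) * ∑ t ∈ Finset.Icc 1 T, 1 / (t : ℝ) ^ (1 / 2 : ℝ) := by
        rw [Finset.mul_sum]
        exact Finset.sum_le_sum fun t _ => stepAlpha_le hc t
    _ ≤ √(1 / (c - 1)) * ((T : ℝ) ^ (1 - 1 / 2 : ℝ) / (1 - 1 / 2)) := by
        gcongr
        exact sum_one_div_rpow_le (by norm_num) (by norm_num) T
    _ = 2 * √(1 / (c - 1)) * (T : ℝ) ^ (1 / 2 : ℝ) := by
        norm_num
        ring

lemma stepBeta_mul_regGamma (κ : ℝ) (ht : 1 ≤ t) : stepBeta κ t * regGamma κ t = 1 / t := by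
  rw [stepBeta, regGamma, one_div_mul_one_div, ← Real.rpow_add (Nat.cast_pos.2 ht),
    add_sub_cancel, Real.rpow_one]

lemma regGamma_pos (κ : ℝ) (ht : 1 ≤ t) : 0 < regGamma κ t :=
  one_div_pos.2 (Real.rpow_pos_of_pos (Nat.cast_pos.2 ht) _)

lemma stepBeta_succ_le (hκ : 0 ≤ κ) (ht : 1 ≤ t) : stepBeta κ (t + 1) ≤ stepBeta κ t :=
  one_div_le_one_div_of_le (Real.rpow_pos_of_pos (Nat.cast_pos.2 ht) _)
    (Real.rpow_le_rpow t.cast_nonneg (Nat.cast_le.2 (Nat.le_succ t)) hκ)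

lemma sum_stepBeta_le (hκ₀ : 0 ≤ κ) (hκ₁ : κ < 1) (T : ℕ) :
    ∑ t ∈ Finset.Ico 1 T, stepBeta κ (t + 1) ≤ (T : ℝ) ^ (1 - κ) / (1 - κ) :=
  (sum_Ico_succ_le_sum_Icc (fun t => one_div_nonneg.2 (Real.rpow_nonneg t.cast_nonneg κ)) T).trans
    (sum_one_div_rpow_le hκ₀ hκ₁ T)

lemma sum_regGamma_le (hκ₀ : 0 < κ) (hκ₁ : κ ≤ 1) (T : ℕ) :
    ∑ t ∈ Finset.Ico 1 T, regGamma κ (t + 1) ≤ (T : ℝ) ^ κ / κ := by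
  simpa only [sub_sub_cancel] using
    (sum_Ico_succ_le_sum_Icc (u := regGamma κ)
      (fun t => one_div_nonneg.2 (Real.rpow_nonneg t.cast_nonneg _)) T).trans
      (sum_one_div_rpow_le (sub_nonneg.2 hκ₁) (sub_lt_self 1 hκ₀) T)

-- Both sides have numerator `t`: `1 / γ_t = t / t^κ` and `1 / γ_{t+1} - β_{t+1} = t / (t+1)^κ`.
lemma one_sub_div_regGamma_succ_le (hκ : 0 ≤ κ) (ht : 1 ≤ t) :
    (1 - stepBeta κ (t + 1) * regGamma κ (t + 1)) / regGamma κ (t + 1) ≤ 1 / regGamma κ t := by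
  have inv_regGamma (s : ℕ) (hs : 1 ≤ s) : 1 / regGamma κ s = s * stepBeta κ s := by
    have hs' : (s : ℝ) ≠ 0 := Nat.cast_ne_zero.2 (Nat.one_le_iff_ne_zero.1 hs)
    rw [div_eq_iff (regGamma_pos κ hs).ne', mul_assoc, stepBeta_mul_regGamma κ hs,
      mul_one_div_cancel hs']
  have ht' : 1 ≤ t + 1 := Nat.le_succ_of_le ht
  rw [sub_div, mul_div_cancel_right₀ _ (regGamma_pos κ ht').ne', inv_regGamma _ ht',
    inv_regGamma t ht, ← sub_one_mul, Nat.cast_succ, add_sub_cancel_right]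
  exact mul_le_mul_of_nonneg_left (stepBeta_succ_le hκ ht) t.cast_nonneg

lemma admissibleStepSizes (hc : 1 < c) (hκ : 0 ≤ κ) :
    AdmissibleStepSizes (stepAlpha (geomThreshold c)) (stepBeta κ) (regGamma κ) where
  alpha_pos _ := stepAlpha_pos hc
  alpha_succ_le _ := stepAlpha_succ_le hc
  beta_nonneg t _ := one_div_nonneg.2 (Real.rpow_nonneg t.cast_nonneg κ)
  beta_succ_le _ := stepBeta_succ_le hκ
  gamma_pos _ := regGamma_pos κ
  beta_mul_gamma_le_one t ht := by
    rw [stepBeta_mul_regGamma κ ht]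
    exact div_le_one_of_le₀ (Nat.one_le_cast.2 ht) t.cast_nonneg
  one_sub_div_gamma_succ_le _ := one_sub_div_regGamma_succ_le hκ

end StepSizes

section Rates

variable {K κ T ℓ L V A Q : ℝ}

/-- The estimates that determine the rates. Here `T` is the horizon, `ℓ` the path-length of the
comparator, and `L`, `V`, `A`, `Q` stand for the local regret, the local violation, the total step
and the step energy. -/
structure RateEstimates (K κ T ℓ L V A Q : ℝ) : Prop where
  const_pos : 0 < K
  horizon_ge_one : 1 ≤ T
  path_nonneg : 0 ≤ ℓ
  step_nonneg : 0 ≤ A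
  energy_nonneg : 0 ≤ Q
  weighted_le : ∀ r : ℝ, 0 ≤ r → L + r * V + Q / 2 ≤
    K * (T ^ κ + T ^ (1 / 2 : ℝ) * (1 + ℓ) + r ^ 2 * T ^ (1 - κ) + (1 + r) * (1 + A))
  step_le : ∀ s : ℝ, 0 < s → A ≤ Q / s + s * (K * T ^ (1 / 2 : ℝ))
  neg_le_regret : -(K * T) ≤ L

namespace RateEstimates

lemma horizon_pos (h : RateEstimates K κ T ℓ L V A Q) : 0 < T :=
  zero_lt_one.trans_le h.horizon_ge_one

lemma horizon_mul_eq (h : RateEstimates K κ T ℓ L V A Q) :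
    T * (1 + ℓ / T ^ (1 / 2 : ℝ)) = T + T ^ (1 / 2 : ℝ) * ℓ := by
  have half : T ^ (1 / 2 : ℝ) * T ^ (1 / 2 : ℝ) = T := by
    rw [← Real.rpow_add h.horizon_pos, add_halves, Real.rpow_one]
  have : 0 < T ^ (1 / 2 : ℝ) := Real.rpow_pos_of_pos h.horizon_pos _
  nth_rewrite 1 [← half]
  field_simp
  linarith

-- The choice `s = 4 K` lets half of the energy absorb the terms `2 K A`.
lemma regret_le (h : RateEstimates K κ T ℓ L V A Q) :
    L + K * (1 + A) ≤
      (4 * K + 8 * K ^ 3) * (T ^ max κ (1 / 2) + T ^ (1 / 2 : ℝ) * ℓ) := by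
  have hK := h.const_pos
  have hT := h.horizon_ge_one
  have weighted := h.weighted_le 0 le_rfl
  have absorb : 2 * K * A ≤ Q / 2 + 8 * K ^ 3 * T ^ (1 / 2 : ℝ) :=
    calc 2 * K * A ≤ 2 * K * (Q / (4 * K) + 4 * K * (K * T ^ (1 / 2 : ℝ))) := by
          gcongr
          exact h.step_le (4 * K) (by positivity)
      _ = Q / 2 + 8 * K ^ 3 * T ^ (1 / 2 : ℝ) := by
          field_simp
          ring
  have pow_kappa : T ^ κ ≤ T ^ max κ (1 / 2) :=
    Real.rpow_le_rpow_of_exponent_le hT (le_max_left _ _)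
  have pow_half : T ^ (1 / 2 : ℝ) ≤ T ^ max κ (1 / 2) :=
    Real.rpow_le_rpow_of_exponent_le hT (le_max_right _ _)
  have one_le : 1 ≤ T ^ (1 / 2 : ℝ) := Real.one_le_rpow hT (by norm_num)
  have path : 0 ≤ T ^ (1 / 2 : ℝ) * ℓ := mul_nonneg (by positivity) h.path_nonneg
  calc L + K * (1 + A)
      ≤ K * (T ^ κ + T ^ (1 / 2 : ℝ) + T ^ (1 / 2 : ℝ) * ℓ) + 2 * K * 1 +
          8 * K ^ 3 * T ^ (1 / 2 : ℝ) := by linarith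
    _ ≤ K * (T ^ max κ (1 / 2) + T ^ max κ (1 / 2) + T ^ (1 / 2 : ℝ) * ℓ) +
          2 * K * T ^ max κ (1 / 2) + 8 * K ^ 3 * T ^ max κ (1 / 2) := by
        gcongr
        exact one_le.trans pow_half
    _ ≤ (4 * K + 8 * K ^ 3) * (T ^ max κ (1 / 2) + T ^ (1 / 2 : ℝ) * ℓ) := by
        have : 0 ≤ (3 * K + 8 * K ^ 3) * (T ^ (1 / 2 : ℝ) * ℓ) := by positivity
        linarith

lemma energy_le (h : RateEstimates K κ T ℓ L V A Q) (hκ : κ ≤ 1) :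
    Q ≤ (16 * K + 16 * K ^ 3) * (T * (1 + ℓ / T ^ (1 / 2 : ℝ))) := by
  have hK := h.const_pos
  have hT := h.horizon_ge_one
  have weighted := h.weighted_le 0 le_rfl
  have lower := h.neg_le_regret
  have absorb : K * A ≤ Q / 4 + 4 * K ^ 3 * T ^ (1 / 2 : ℝ) :=
    calc K * A ≤ K * (Q / (4 * K) + 4 * K * (K * T ^ (1 / 2 : ℝ))) := by
          gcongr
          exact h.step_le (4 * K) (by positivity)
      _ = Q / 4 + 4 * K ^ 3 * T ^ (1 / 2 : ℝ) := by
          field_simp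
  have path : 0 ≤ T ^ (1 / 2 : ℝ) * ℓ := mul_nonneg (by positivity) h.path_nonneg
  rw [h.horizon_mul_eq]
  calc Q ≤ 4 * (K * (T ^ κ + T ^ (1 / 2 : ℝ) + T ^ (1 / 2 : ℝ) * ℓ + 1 + T) +
          4 * K ^ 3 * T ^ (1 / 2 : ℝ)) := by linarith
    _ ≤ 4 * (K * (T + T + T ^ (1 / 2 : ℝ) * ℓ + T + T) + 4 * K ^ 3 * T) := by
        gcongr
        · exact Real.rpow_le_self_of_one_le hT hκ
        · exact Real.rpow_le_self_of_one_le hT (by norm_num)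
        · exact Real.rpow_le_self_of_one_le hT (by norm_num)
    _ ≤ (16 * K + 16 * K ^ 3) * (T + T ^ (1 / 2 : ℝ) * ℓ) := by
        have : 0 ≤ (12 * K + 16 * K ^ 3) * (T ^ (1 / 2 : ℝ) * ℓ) := by positivity
        linarith

lemma totalStep_le (h : RateEstimates K κ T ℓ L V A Q) (hκ : κ ≤ 1) :
    A ≤ (17 * K + 16 * K ^ 3) * (T ^ (3 / 4 : ℝ) * (1 + ℓ / T ^ (1 / 2 : ℝ))) := by
  have hK := h.const_pos
  have hT := h.horizon_pos
  have hρ : 0 ≤ ℓ / T ^ (1 / 2 : ℝ) := div_nonneg h.path_nonneg (by positivity)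
  have split : T = T ^ (1 / 4 : ℝ) * T ^ (3 / 4 : ℝ) := by
    rw [← Real.rpow_add hT]; norm_num
  have merge : T ^ (1 / 4 : ℝ) * T ^ (1 / 2 : ℝ) = T ^ (3 / 4 : ℝ) := by
    rw [← Real.rpow_add hT]; norm_num
  have energy : Q / T ^ (1 / 4 : ℝ) ≤
      (16 * K + 16 * K ^ 3) * (T ^ (3 / 4 : ℝ) * (1 + ℓ / T ^ (1 / 2 : ℝ))) := by
    rw [div_le_iff₀' (by positivity)]
    refine (h.energy_le hκ).trans_eq ?_
    nth_rewrite 1 [split]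
    ring
  calc A ≤ Q / T ^ (1 / 4 : ℝ) + T ^ (1 / 4 : ℝ) * (K * T ^ (1 / 2 : ℝ)) :=
        h.step_le _ (by positivity)
    _ = Q / T ^ (1 / 4 : ℝ) + K * (T ^ (3 / 4 : ℝ) * 1) := by rw [← merge]; ring
    _ ≤ (16 * K + 16 * K ^ 3) * (T ^ (3 / 4 : ℝ) * (1 + ℓ / T ^ (1 / 2 : ℝ))) +
          K * (T ^ (3 / 4 : ℝ) * (1 + ℓ / T ^ (1 / 2 : ℝ))) := by
        gcongr
        linarith
    _ = (17 * K + 16 * K ^ 3) * (T ^ (3 / 4 : ℝ) * (1 + ℓ / T ^ (1 / 2 : ℝ))) := by ring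

-- The weight `r = T ^ (κ / 2)` balances `T / r` against `r T ^ (1 - κ)`.
lemma violation_le_add (h : RateEstimates K κ T ℓ L V A Q) (hκ₀ : 0 ≤ κ) (hκ₁ : κ ≤ 1) :
    V ≤ 4 * K * (T ^ (1 - κ / 2) * (1 + ℓ / T ^ (1 / 2 : ℝ))) + 2 * K * (1 + A) := by
  have hK := h.const_pos
  have hT := h.horizon_ge_one
  have hT₀ := h.horizon_pos
  set r := T ^ (κ / 2) with hr
  have one_le_r : 1 ≤ r := Real.one_le_rpow hT (by positivity)
  have weighted := h.weighted_le r (by positivity)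
  have r_sq_mul : r ^ 2 * T ^ (1 - κ) = T := by
    rw [hr, ← Real.rpow_natCast, ← Real.rpow_mul hT₀.le, ← Real.rpow_add hT₀]
    norm_num
  have r_mul : r * T ^ (1 - κ / 2) = T := by
    rw [hr, ← Real.rpow_add hT₀, add_sub_cancel, Real.rpow_one]
  have path : 0 ≤ T ^ (1 / 2 : ℝ) * ℓ := mul_nonneg (by positivity) h.path_nonneg
  have hA : 0 ≤ 1 + A := add_nonneg zero_le_one h.step_nonneg
  rw [r_sq_mul] at weighted
  refine le_of_mul_le_mul_left ?_ (zero_lt_one.trans_le one_le_r)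
  calc r * V ≤ K * (T ^ κ + T ^ (1 / 2 : ℝ) + T ^ (1 / 2 : ℝ) * ℓ + T + (1 + r) * (1 + A)) +
          K * T := by linarith [h.neg_le_regret, h.energy_nonneg]
    _ ≤ K * (T + T + T ^ (1 / 2 : ℝ) * ℓ + T + (r + r) * (1 + A)) + K * T := by
        gcongr
        · exact Real.rpow_le_self_of_one_le hT hκ₁
        · exact Real.rpow_le_self_of_one_le hT (by norm_num)
    _ ≤ 4 * K * (T + T ^ (1 / 2 : ℝ) * ℓ) + r * (2 * K * (1 + A)) := by
        have : 0 ≤ 3 * K * (T ^ (1 / 2 : ℝ) * ℓ) := by positivity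
        linarith
    _ = r * (4 * K * (T ^ (1 - κ / 2) * (1 + ℓ / T ^ (1 / 2 : ℝ))) + 2 * K * (1 + A)) := by
        rw [← h.horizon_mul_eq]
        nth_rewrite 1 [← r_mul]
        ring

lemma violation_le (h : RateEstimates K κ T ℓ L V A Q) (hκ₀ : 0 ≤ κ) (hκ₁ : κ ≤ 1) :
    V + K * (1 + A) ≤ (4 * K + 3 * K * (1 + (17 * K + 16 * K ^ 3))) *
      (T ^ max (1 - κ / 2) (3 / 4) * (1 + ℓ / T ^ (1 / 2 : ℝ))) := by
  have hK := h.const_pos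
  have hT := h.horizon_ge_one
  have := h.horizon_pos
  have hρ : 1 ≤ 1 + ℓ / T ^ (1 / 2 : ℝ) :=
    le_add_of_nonneg_right (div_nonneg h.path_nonneg (by positivity))
  have one_le : 1 ≤ T ^ (3 / 4 : ℝ) * (1 + ℓ / T ^ (1 / 2 : ℝ)) :=
    one_le_mul_of_one_le_of_one_le (Real.one_le_rpow hT (by norm_num)) hρ
  calc V + K * (1 + A)
      ≤ 4 * K * (T ^ (1 - κ / 2) * (1 + ℓ / T ^ (1 / 2 : ℝ))) + 3 * K * (1 + A) := by
        linarith [h.violation_le_add hκ₀ hκ₁]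
    _ ≤ 4 * K * (T ^ (1 - κ / 2) * (1 + ℓ / T ^ (1 / 2 : ℝ))) +
          3 * K * ((1 + (17 * K + 16 * K ^ 3)) *
            (T ^ (3 / 4 : ℝ) * (1 + ℓ / T ^ (1 / 2 : ℝ)))) := by
        gcongr
        rw [add_mul, one_mul]
        exact add_le_add one_le (h.totalStep_le hκ₁)
    _ ≤ 4 * K * (T ^ max (1 - κ / 2) (3 / 4) * (1 + ℓ / T ^ (1 / 2 : ℝ))) +
          3 * K * ((1 + (17 * K + 16 * K ^ 3)) *
            (T ^ max (1 - κ / 2) (3 / 4) * (1 + ℓ / T ^ (1 / 2 : ℝ)))) := by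
        gcongr
        · exact le_max_left _ _
        · exact le_max_right _ _
    _ = _ := by ring

end RateEstimates

end Rates

open Filter

section StandardRuns

variable {n p : ℕ} {m : Fin n → ℕ} {P : Problem n p m} {F₁ F₂ R w κ c : ℝ} {B T : ℕ}
  {S : Trajectory n p m} {y : ℕ → Vec p}

/-- A run of the algorithm with the step sizes of the paper, on a problem that satisfies its
assumptions. -/
structure StandardRun (P : Problem n p m) (F₁ F₂ R w κ c : ℝ) (B T : ℕ) (S : Trajectory n p m) :
    Prop where
  data : P.RegularData F₁ F₂ R
  subgradients : P.PosPartSubgradients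
  network : P.RegularNetwork w B
  horizon : 1 ≤ T
  generated : IsGenerated P (stepAlpha (geomThreshold c)) (stepBeta κ) (regGamma κ)
    (geomThreshold c) T S

lemma sum_geomThreshold_le_mul (hc : 1 < c) (T : ℕ) {a : ℝ} (ha : 1 ≤ a) :
    ∑ t ∈ Finset.Icc 1 T, geomThreshold c t ≤ 1 / (c - 1) * a :=
  (sum_geomThreshold_le hc T).trans
    (le_mul_of_one_le_right (one_div_nonneg.2 (sub_nonneg.2 hc.le)) ha)

namespace StandardRun

lemma one_le_horizon (h : StandardRun P F₁ F₂ R w κ c B T S) : (1 : ℝ) ≤ T :=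
  Nat.one_le_cast.2 h.horizon

lemma sum_deviation_xhat_le (hn : 0 < n) (hR : 0 ≤ R) (hw : 0 < w) (hc : 1 < c)
    (h : StandardRun P F₁ F₂ R w κ c B T S) :
    ∑ t ∈ Finset.Icc 1 T, deviation (fun i => S.xhat i t) ≤
      2 * (n * B : ℕ) / (n * w ^ (n * B)) * (n * R + n * (1 / (c - 1)) + 1) *
        (1 + totalStep S T) := by
  have : 0 < c - 1 := sub_pos.2 hc
  have hA := totalStep_nonneg S T
  have sum_le := h.generated.sum_deviation_xhat_le h.data h.network hw hR
    fun t => (geomThreshold_pos hc t).le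
  rw [mul_comm, ← le_div_iff₀ (by positivity), mul_div_right_comm] at sum_le
  refine sum_le.trans ?_
  rw [mul_assoc]
  gcongr
  calc n * R + (totalStep S T + n * ∑ t ∈ Finset.Icc 1 T, geomThreshold c t)
      ≤ n * R + (totalStep S T + n * (1 / (c - 1))) := by
        gcongr
        exact sum_geomThreshold_le hc T
    _ ≤ (n * R + n * (1 / (c - 1)) + 1) * (1 + totalStep S T) := by
        have : 0 ≤ (n * R + n * (1 / (c - 1))) * totalStep S T := by positivity
        linarith

variable (m F₁ F₂ κ B)

lemma eventually_disagreement_le (hn : 0 < n) (hR : 0 ≤ R) (hw : 0 < w) (hc : 1 < c) :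
    ∀ᶠ K : ℝ in atTop, ∀ ⦃p : ℕ⦄ ⦃P : Problem n p m⦄ ⦃T : ℕ⦄ ⦃S : Trajectory n p m⦄,
      StandardRun P F₁ F₂ R w κ c B T S → disagreement S T ≤ K * (1 + totalStep S T) := by
  set K₁ : ℝ := 2 * (n * B : ℕ) / (n * w ^ (n * B)) * (n * R + n * (1 / (c - 1)) + 1)
  filter_upwards [eventually_ge_atTop (2 * n * (K₁ + n * (1 / (c - 1))))] with K hK p P T S h
  have hA := totalStep_nonneg S T
  calc disagreement S T ≤ 2 * n * (∑ t ∈ Finset.Icc 1 T, deviation (fun i => S.xhat i t) +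
          n * ∑ t ∈ Finset.Icc 1 T, geomThreshold c t) :=
        h.generated.disagreement_le fun t => (geomThreshold_pos hc t).le
    _ ≤ 2 * n * (K₁ * (1 + totalStep S T) + n * (1 / (c - 1) * (1 + totalStep S T))) := by
        gcongr
        · exact h.sum_deviation_xhat_le hn hR hw hc
        · exact sum_geomThreshold_le_mul hc T (le_add_of_nonneg_right hA)
    _ = 2 * n * (K₁ + n * (1 / (c - 1))) * (1 + totalStep S T) := by ring
    _ ≤ K * (1 + totalStep S T) := by gcongr

lemma eventually_totalMovement_le (hn : 0 < n) (hR : 0 ≤ R) (hw : 0 < w) (hc : 1 < c) :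
    ∀ᶠ K : ℝ in atTop, ∀ ⦃p : ℕ⦄ ⦃P : Problem n p m⦄ ⦃T : ℕ⦄ ⦃S : Trajectory n p m⦄,
      StandardRun P F₁ F₂ R w κ c B T S → totalMovement S T ≤ K * (1 + totalStep S T) := by
  set K₁ : ℝ := 2 * (n * B : ℕ) / (n * w ^ (n * B)) * (n * R + n * (1 / (c - 1)) + 1)
  filter_upwards [eventually_ge_atTop (1 + 2 * K₁ + n * (1 / (c - 1)))] with K hK p P T S h
  have hA := totalStep_nonneg S T
  calc totalMovement S T
      ≤ totalStep S T + (2 * ∑ t ∈ Finset.Icc 1 T, deviation (fun i => S.xhat i t) +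
          n * ∑ t ∈ Finset.Icc 1 T, geomThreshold c t) :=
        h.generated.totalMovement_le h.network hw fun t => (geomThreshold_pos hc t).le
    _ ≤ (1 + totalStep S T) + (2 * (K₁ * (1 + totalStep S T)) +
          n * (1 / (c - 1) * (1 + totalStep S T))) := by
        gcongr
        · exact le_add_of_nonneg_left zero_le_one
        · exact h.sum_deviation_xhat_le hn hR hw hc
        · exact sum_geomThreshold_le_mul hc T (le_add_of_nonneg_right hA)
    _ = (1 + 2 * K₁ + n * (1 / (c - 1))) * (1 + totalStep S T) := by ring
    _ ≤ K * (1 + totalStep S T) := by gcongr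

lemma eventually_mul_totalMovement_le (hn : 0 < n) (hF₂ : 0 ≤ F₂) (hR : 0 ≤ R) (hw : 0 < w)
    (hc : 1 < c) :
    ∀ᶠ K : ℝ in atTop, ∀ ⦃p : ℕ⦄ ⦃P : Problem n p m⦄ ⦃T : ℕ⦄ ⦃S : Trajectory n p m⦄,
      StandardRun P F₁ F₂ R w κ c B T S → ∀ r : ℝ, 0 ≤ r →
        F₂ * (1 + (∑ i, m i : ℕ) * r) * totalMovement S T ≤
          K * ((1 + r) * (1 + totalStep S T)) := by
  obtain ⟨K₀, hK₀, movement⟩ := ((eventually_ge_atTop 0).and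
    (eventually_totalMovement_le m F₁ F₂ κ B hn hR hw hc)).exists
  set M : ℝ := ((∑ i, m i : ℕ) : ℝ)
  have hM : 0 ≤ M := Nat.cast_nonneg _
  filter_upwards [eventually_ge_atTop (F₂ * (1 + M) * K₀)] with K hK p P T S h r hr
  have hA := totalStep_nonneg S T
  calc F₂ * (1 + M * r) * totalMovement S T
      ≤ F₂ * (1 + M * r) * (K₀ * (1 + totalStep S T)) := by
        gcongr
        exact movement h
    _ ≤ F₂ * ((1 + M) * (1 + r)) * (K₀ * (1 + totalStep S T)) := by
        gcongr
        linarith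
    _ = F₂ * (1 + M) * K₀ * ((1 + r) * (1 + totalStep S T)) := by ring
    _ ≤ K * ((1 + r) * (1 + totalStep S T)) := by gcongr

lemma eventually_endpoint_le (hn : 0 < n) (hF₁ : 0 ≤ F₁) (hF₂ : 0 ≤ F₂) (hR : 0 ≤ R)
    (hw : 0 < w) (hc : 1 < c) :
    ∀ᶠ K : ℝ in atTop, ∀ ⦃p : ℕ⦄ ⦃P : Problem n p m⦄ ⦃T : ℕ⦄ ⦃S : Trajectory n p m⦄,
      StandardRun P F₁ F₂ R w κ c B T S →
        n * F₁ + F₂ * disagreement S T ≤ K * (1 + totalStep S T) := by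
  obtain ⟨K₀, disagree⟩ := (eventually_disagreement_le m F₁ F₂ κ B hn hR hw hc).exists
  filter_upwards [eventually_ge_atTop (n * F₁ + F₂ * K₀)] with K hK p P T S h
  have hA := totalStep_nonneg S T
  calc n * F₁ + F₂ * disagreement S T
      ≤ n * (F₁ * (1 + totalStep S T)) + F₂ * (K₀ * (1 + totalStep S T)) := by
        gcongr
        · exact le_mul_of_one_le_right hF₁ (le_add_of_nonneg_right hA)
        · exact disagree h
    _ = (n * F₁ + F₂ * K₀) * (1 + totalStep S T) := by ring
    _ ≤ K * (1 + totalStep S T) := by gcongr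

end StandardRun

variable (n)

lemma eventually_comparator_le (hR : 0 ≤ R) (hc : 1 < c) :
    ∀ᶠ K : ℝ in atTop, ∀ T : ℕ, 1 ≤ T → ∀ ℓ : ℝ, 0 ≤ ℓ →
      2 * n * R * (R + ∑ t ∈ Finset.Icc 1 T, geomThreshold c t + ℓ) /
        stepAlpha (geomThreshold c) T ≤ K * ((T : ℝ) ^ (1 / 2 : ℝ) * (1 + ℓ)) := by
  have : 0 < c - 1 := sub_pos.2 hc
  filter_upwards [eventually_ge_atTop (2 * n * R * (R + 1 / (c - 1) + 1) * √c)]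
    with K hK T hT ℓ hℓ
  have hα := stepAlpha_pos hc hT
  calc 2 * n * R * (R + ∑ t ∈ Finset.Icc 1 T, geomThreshold c t + ℓ) /
        stepAlpha (geomThreshold c) T
      ≤ 2 * n * R * ((R + 1 / (c - 1) + 1) * (1 + ℓ)) * (√c * (T : ℝ) ^ (1 / 2 : ℝ)) := by
        rw [div_eq_mul_one_div]
        have : 0 ≤ (R + 1 / (c - 1)) * ℓ := by positivity
        gcongr
        · linarith [sum_geomThreshold_le hc T]
        · exact one_div_stepAlpha_le hc hT
    _ = 2 * n * R * (R + 1 / (c - 1) + 1) * √c * ((T : ℝ) ^ (1 / 2 : ℝ) * (1 + ℓ)) := by ring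
    _ ≤ K * ((T : ℝ) ^ (1 / 2 : ℝ) * (1 + ℓ)) := by gcongr

lemma eventually_sum_stepAlpha_le (hc : 1 < c) :
    ∀ᶠ K : ℝ in atTop, ∀ T : ℕ,
      n * ∑ t ∈ Finset.Ico 1 T, stepAlpha (geomThreshold c) (t + 1) ≤
        K * (T : ℝ) ^ (1 / 2 : ℝ) := by
  filter_upwards [eventually_ge_atTop (n * (2 * √(1 / (c - 1))))] with K hK T
  calc n * ∑ t ∈ Finset.Ico 1 T, stepAlpha (geomThreshold c) (t + 1)
      ≤ n * (2 * √(1 / (c - 1)) * (T : ℝ) ^ (1 / 2 : ℝ)) := by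
        gcongr
        exact sum_stepAlpha_le hc T
    _ = n * (2 * √(1 / (c - 1))) * (T : ℝ) ^ (1 / 2 : ℝ) := by ring
    _ ≤ K * (T : ℝ) ^ (1 / 2 : ℝ) := by gcongr

variable {n} (m F₁ F₂ R)

lemma eventually_regularization_le (hκ₀ : 0 < κ) (hκ₁ : κ < 1) :
    ∀ᶠ K : ℝ in atTop, ∀ T : ℕ, 1 ≤ T → ∀ r : ℝ,
      n * ((2 * F₁ + 2 * R * F₂) ^ 2 / 2 * ∑ t ∈ Finset.Ico 1 T, regGamma κ (t + 1) +
        ((∑ i, m i : ℕ) * r) ^ 2 / 2 *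
          (∑ t ∈ Finset.Ico 1 T, stepBeta κ (t + 1) + 1 / regGamma κ 1)) ≤
      K * ((T : ℝ) ^ κ + r ^ 2 * (T : ℝ) ^ (1 - κ)) := by
  set M : ℝ := ((∑ i, m i : ℕ) : ℝ)
  filter_upwards [eventually_ge_atTop (n * ((2 * F₁ + 2 * R * F₂) ^ 2 / 2 / κ)),
    eventually_ge_atTop (n * (M ^ 2 / 2 * (1 / (1 - κ) + 1)))] with K hK₁ hK₂ T hT r
  have gamma_one : 1 / regGamma κ 1 ≤ (T : ℝ) ^ (1 - κ) := by
    simpa [regGamma] using Real.one_le_rpow (Nat.one_le_cast.2 hT) (sub_nonneg.2 hκ₁.le)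
  calc n * ((2 * F₁ + 2 * R * F₂) ^ 2 / 2 * ∑ t ∈ Finset.Ico 1 T, regGamma κ (t + 1) +
        (M * r) ^ 2 / 2 * (∑ t ∈ Finset.Ico 1 T, stepBeta κ (t + 1) + 1 / regGamma κ 1))
      ≤ n * ((2 * F₁ + 2 * R * F₂) ^ 2 / 2 * ((T : ℝ) ^ κ / κ) +
          (M * r) ^ 2 / 2 * ((T : ℝ) ^ (1 - κ) / (1 - κ) + (T : ℝ) ^ (1 - κ))) := by
        gcongr
        · exact sum_regGamma_le hκ₀ hκ₁.le T
        · exact sum_stepBeta_le hκ₀.le hκ₁ T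
    _ = n * ((2 * F₁ + 2 * R * F₂) ^ 2 / 2 / κ) * (T : ℝ) ^ κ +
          n * (M ^ 2 / 2 * (1 / (1 - κ) + 1)) * (r ^ 2 * (T : ℝ) ^ (1 - κ)) := by ring
    _ ≤ K * (T : ℝ) ^ κ + K * (r ^ 2 * (T : ℝ) ^ (1 - κ)) := by gcongr
    _ = K * ((T : ℝ) ^ κ + r ^ 2 * (T : ℝ) ^ (1 - κ)) := by ring

variable {F₁ F₂ R}

lemma eventually_rateEstimates (hn : 0 < n) (B : ℕ) (hF₁ : 0 ≤ F₁) (hF₂ : 0 ≤ F₂)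
    (hR : 0 ≤ R) (hw : 0 < w) (hκ₀ : 0 < κ) (hκ₁ : κ < 1) (hc : 1 < c) :
    ∀ᶠ K : ℝ in atTop, ∀ ⦃p : ℕ⦄ ⦃P : Problem n p m⦄ ⦃T : ℕ⦄ ⦃S : Trajectory n p m⦄,
      StandardRun P F₁ F₂ R w κ c B T S → ∀ y ∈ P.feasibleSequences T,
        RateEstimates K κ T (pathLength T y) (localRegret P S T y) (localViolation P S T)
          (totalStep S T) (stepEnergy (stepAlpha (geomThreshold c)) S T) := by
  filter_upwards [eventually_gt_atTop 0, eventually_regularization_le m F₁ F₂ R hκ₀ hκ₁,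
    StandardRun.eventually_mul_totalMovement_le m F₁ F₂ κ B hn hF₂ hR hw hc,
    eventually_comparator_le n hR hc, eventually_sum_stepAlpha_le n hc,
    eventually_ge_atTop (n * F₁)]
    with K hK regularization movement comparator alpha_sum hK_loss p P T S h y hy
  exact
    { const_pos := hK
      horizon_ge_one := h.one_le_horizon
      path_nonneg := pathLength_nonneg T y
      step_nonneg := totalStep_nonneg S T
      energy_nonneg := stepEnergy_nonneg fun t => stepAlpha_pos hc
      weighted_le := fun r hr => by
        linarith [h.generated.localRegret_add_mul_localViolation_le h.data h.subgradients
          h.network hw hF₁ hF₂ hR (admissibleStepSizes hc hκ₀.le)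
          (fun t => (geomThreshold_pos hc t).le) h.horizon hy hr,
          regularization T h.horizon r, movement h r hr,
          comparator T h.horizon _ (pathLength_nonneg T y)]
      step_le := fun s hs =>
        (totalStep_le_stepEnergy_div_add (fun t => stepAlpha_pos hc) hs).trans
          (add_le_add_right (mul_le_mul_of_nonneg_left (alpha_sum T) hs.le) _)
      neg_le_regret := (neg_le_neg (mul_le_mul_of_nonneg_right hK_loss T.cast_nonneg)).trans
        (h.generated.neg_le_localRegret h.data hF₁ hy) }

end StandardRuns

end EventTriggered

open EventTriggered in
theorem corollary2_general {n : ℕ} (hn : 0 < n) (m : Fin n → ℕ) {F₁ F₂ R w κ c : ℝ} (B : ℕ)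
    (hF₁ : 0 ≤ F₁) (hF₂ : 0 ≤ F₂) (hR : 0 ≤ R) (hw : 0 < w) (hκ₀ : 0 < κ) (hκ₁ : κ < 1)
    (hc : 1 < c) :
    ∃ C : ℝ, 0 < C ∧ ∀ (p : ℕ) (P : Problem n p m) (T : ℕ) (S : Trajectory n p m),
      StandardRun P F₁ F₂ R w κ c B T S → ∀ y ∈ P.feasibleSequences T,
        netReg P T S.x y ≤
          C * ((T : ℝ) ^ max κ (1 / 2) + (T : ℝ) ^ (1 / 2 : ℝ) * pathLength T y) ∧
        netCCV P T S.x ≤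
          C * ((T : ℝ) ^ max (1 - κ / 2) (3 / 4) *
            (1 + pathLength T y / (T : ℝ) ^ (1 / 2 : ℝ))) := by
  obtain ⟨K, hK, estimates, endpoint⟩ := ((Filter.eventually_gt_atTop 0).and
    ((eventually_rateEstimates m hn B hF₁ hF₂ hR hw hκ₀ hκ₁ hc).and
      (StandardRun.eventually_endpoint_le m F₁ F₂ κ B hn hF₁ hF₂ hR hw hc))).exists
  set C₁ := 4 * K + 8 * K ^ 3
  set C₂ := 4 * K + 3 * K * (1 + (17 * K + 16 * K ^ 3))
  refine ⟨max C₁ C₂, lt_max_of_lt_left (by positivity), fun p P T S h y hy => ?_⟩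
  have hℓ := pathLength_nonneg T y
  have rates := estimates h y hy
  constructor
  · set bound := (T : ℝ) ^ max κ (1 / 2) + (T : ℝ) ^ (1 / 2 : ℝ) * pathLength T y
    have regret : n * netReg P T S.x y ≤ n * (max C₁ C₂ * bound) :=
      calc n * netReg P T S.x y ≤ localRegret P S T y + K * (1 + totalStep S T) := by
            linarith [h.generated.natCast_mul_netReg_le h.data hF₂ hn h.horizon hy, endpoint h]
        _ ≤ C₁ * bound := rates.regret_le
        _ ≤ max C₁ C₂ * bound := by
            gcongr
            exact le_max_left _ _
        _ ≤ n * (max C₁ C₂ * bound) :=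
            le_mul_of_one_le_left (by positivity) (Nat.one_le_cast.2 hn)
    exact le_of_mul_le_mul_left regret (Nat.cast_pos.2 hn)
  · set bound := (T : ℝ) ^ max (1 - κ / 2) (3 / 4) * (1 + pathLength T y / (T : ℝ) ^ (1 / 2 : ℝ))
    calc netCCV P T S.x ≤ localViolation P S T + K * (1 + totalStep S T) := by
          linarith [h.generated.netCCV_le h.data h.subgradients hF₂ hn h.horizon, endpoint h]
      _ ≤ C₂ * bound := rates.violation_le hκ₀.le hκ₁.le
      _ ≤ max C₁ C₂ * bound := by
          gcongr
          exact le_max_right _ _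

theorem corollary2 (n : ℕ) (hn : 0 < n) (m : Fin n → ℕ)
    (F₁ F₂ R w κ c : ℝ) (B : ℕ)
    (hF₁ : 0 < F₁) (hF₂ : 0 < F₂) (hR : 0 < R) (hw : 0 < w ∧ w < 1) (hB : 0 < B)
    (hκ : 0 < κ ∧ κ < 1) (hc : 1 < c) :
    ∃ C : ℝ, 0 < C ∧
      ∀ (p : ℕ) (P : EventTriggered.Problem n p m),
        P.RegularData F₁ F₂ R → P.PosPartSubgradients → P.RegularNetwork w B →
        ∀ T : ℕ, 1 ≤ T → (P.feasibleStatic T).Nonempty →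
        ∀ S : EventTriggered.Trajectory n p m,
          EventTriggered.IsGenerated P
            (EventTriggered.stepAlpha (EventTriggered.geomThreshold c))
            (EventTriggered.stepBeta κ) (EventTriggered.regGamma κ)
            (EventTriggered.geomThreshold c) T S →
          (∀ y ∈ P.feasibleSequences T,
            EventTriggered.netReg P T S.x y ≤
              C * ((T : ℝ) ^ max κ (1 / 2) +
                (T : ℝ) ^ (1 / 2 : ℝ) * EventTriggered.pathLength T y)) ∧
          EventTriggered.netCCV P T S.x ≤ C * (T : ℝ) ^ max (1 - κ / 2) (3 / 4) := by
  obtain ⟨C, hC, bound⟩ := corollary2_general hn m B hF₁.le hF₂.le hR.le hw.1 hκ.1 hκ.2 hc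
  refine ⟨C, hC, fun p P hD hP hN T hT hX S hS => ?_⟩
  have run : EventTriggered.StandardRun P F₁ F₂ R w κ c B T S := ⟨hD, hP, hN, hT, hS⟩
  obtain ⟨x₀, hx₀, feasible⟩ := hX
  refine ⟨fun y hy => (bound p P T S run y hy).1, ?_⟩
  simpa [EventTriggered.pathLength] using
    (bound p P T S run (fun _ => x₀) fun t ht => ⟨hx₀, feasible t ht⟩).2
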